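/- **Setting.** Let $X$ be a set, $f:X\to\{0,1\}$ a target, and $H\subseteq\{0,1\}^X$ a class of splitting functions satisfying the Weak Learning Assumption with advantage $\gamma>0$: for every distribution $P$ on $X$ there is $h\in H$ with $\Pr_{x\sim P}(h(x)\ne f(x))\le \frac12-\gamma$. Let $G(q)=-q\log_2 q-(1-q)\log_2(1-q)$. For a finite multiset $S_\ell$ of labelled examples $(x,f(x))$ let $q(S_\ell)$ be the fraction with label $1$, let $S_{\ell,i}$ be the examples with $h(x)=i$, and let $$J(\ell,h)=G(q(S_\ell))-\tfrac{|S_{\ell,0}|}{|S_\ell|}G(q(S_{\ell,0}))-\tfrac{|S_{\ell,1}|}{|S_\ell|}G(q(S_{\ell,1})).$$ **PrivateSplit.** Let $\mathrm{PrivateSplit}(\ell,\alpha,\delta)$ be a randomized algorithm that, from the data $S_\ell$, outputs $(\hat h,\hat J)\in H\times\mathbb R$, such that for all $\alpha>0$, $\delta\in(0,1]$: (1) it is $\alpha$-differentially private; (2) for every $\zeta>0$, if $|S_\ell|\ge N(\zeta,\alpha,\delta)$, then with probability at least $1-\delta$ both $J(\ell,\hat h)\ge\max_{h\in H}J(\ell,h)-\zeta$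 and $|J(\ell,\hat h)-\hat J|\le\zeta$. The data requirement $N(\zeta,\alpha,\delta)$ is assumed to be nonincreasing in $\alpha$. **DP-TopDown.** The input is a finite multiset $S$ of examples $(x,f(x))$, an integer $M\ge1$, $\alpha>0$, $\varepsilon,\delta\in(0,1]$ and a budget function $\mathcal B$ with $\sum_{d=1}^M\mathcal B(d)\le1$ and $b:=\min_{1\le d\le M}\mathcal B(d)>0$. Start with the tree consisting of a single leaf (depth $0$); compute $(\hat h,\hat J)=\mathrm{PrivateSplit}(\ell,\frac\alpha2\mathcal B(1),\frac{\delta}{2(2M+1)})$ for it and push it into a queue with priority $\hat J$. For $t=1,\dots,M$ (stopping if the queue is empty): pop a pair $(\ell^*,h^*)$ of highest priority and split $\ell^*$ by $h^*$; for each new leaf $\ell_i$, put $\alpha_\ell=\frac\alpha2\mathcal B(\mathrm{depth}(\ell_i))$, $w_i=\frac{|S_{\ell_i}|}{|S|}+\mathrm{Lap}(\frac{2}{|S|\alpha_\ell})$, $(\hat h_i,\hat J_i)=\mathrm{PrivateSplit}(\ell_i,\frac{\alpha_\ell}2,\frac{\delta}{2(2M+1)})$, and if $w_i\ge\frac\varepsilon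 M$ push $(\ell_i,\hat h_i)$ with priority $w_i\hat J_i$. Finally label every leaf by its majority label, using Report Noisy Max with budget $\frac\alpha2$ (Laplace noise of scale $4/\alpha$ is added to both label counts). All calls and noises use independent randomness. **Theorem.** There are universal constants $C_1,C_2,c>0$ such that in the above setting, if $$|S|\ \ge\ \max\left(C_2\,\frac{M}{\gamma^2\varepsilon\alpha b}\,\log\frac2\varepsilon\,\log\frac{2M}\delta,\ \ \frac{2M}{\varepsilon}\,N\Big(\frac{c\,\gamma^2\varepsilon}{M\log(2/\varepsilon)},\ \frac{\alpha b}{4},\ \frac{\delta}{2(2M+1)}\Big)\right),$$ then for every integer $t$ with $(1/\varepsilon)^{C_1\log(1/\varepsilon)/\gamma^2}\le t\le M$, the tree obtained by running $t$ iterations of the main loop and labelling the leaves (for $t=M$, the output of DP-TopDown) has training error on $S$ at most $\varepsilon$ with probability at least $1-\delta$. -/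

import Mathlib

open MeasureTheory

noncomputable section

namespace DPTree

/-- A dataset is a finite collection (with repetitions) of labelled examples `(x, y)`. -/
abbrev Dataset (X : Type*) := Multiset (X × Bool)

/-- Every example of `S` carries the label that the target `f` assigns to it. -/
def LabelledBy {X : Type*} (f : X → Bool) (S : Dataset X) : Prop :=
  ∀ p ∈ S, p.2 = f p.1

/-- Two datasets are neighboring if they differ on at most one point. -/
def Neighboring {X : Type*} (S S' : Dataset X) : Prop :=
  ∃ R A A' : Dataset X, A.card ≤ 1 ∧ A'.card ≤ 1 ∧ S = R + A ∧ S' = R + A'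

/-- The entropy splitting criterion `G(q) = -q log₂ q - (1 - q) log₂ (1 - q)`,
normalized so that `G(1/2) = 1`. -/
def G (q : ℝ) : ℝ := Real.binEntropy q / Real.log 2

/-- The number of examples of `S` with label `y`. -/
def labelCount {X : Type*} (S : Dataset X) (y : Bool) : ℕ :=
  (S.filter fun p => p.2 = y).card

/-- The fraction of examples of `S` with label `1` (and `0` if `S` is empty). -/
def q {X : Type*} (S : Dataset X) : ℝ := (labelCount S true : ℝ) / S.card

/-- The examples of `S` that the splitting function `h` sends to the child `i`. -/
def child {X : Type*} (S : Dataset X) (h : X → Bool) (i : Bool) : Dataset X :=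
  S.filter fun p => h p.1 = i

/-- `J(ℓ, h)`, as a function of the data `S = S_ℓ` that reaches the leaf `ℓ`. -/
def J {X : Type*} (S : Dataset X) (h : X → Bool) : ℝ :=
  G (q S) - ((child S h false).card : ℝ) / S.card * G (q (child S h false))
    - ((child S h true).card : ℝ) / S.card * G (q (child S h true))

/-- The Weak Learning Assumption with advantage `γ` of the class `H` for the target `f`, over all
discrete distributions on `X`. -/
def WeakLearning {X : Type*} (H : Set (X → Bool)) (f : X → Bool) (γ : ℝ) : Prop :=
  ∀ P : PMF X, ∃ h ∈ H, (P.toOuterMeasure {x | h x ≠ f x}).toReal ≤ 1 / 2 - γ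

/-! ### Decision trees -/

/-- The shape of a binary decision tree: inner nodes carry splitting functions from `H`. -/
inductive Tree {X : Type*} (H : Set (X → Bool)) where
  | leaf : Tree H
  | node (h : H) (left right : Tree H) : Tree H

/-- Leaves are addressed by the path that leads to them from the root:
`false` means left (`h x = 0`), `true` means right (`h x = 1`).
The depth of a leaf is the length of its address. -/
abbrev Address := List Bool

namespace Tree

variable {X : Type*} {H : Set (X → Bool)}

/-- The address of the leaf that `x` is routed to. -/
def route : Tree H → X → Address
  | leaf, _ => []
  | node h l r, x => if h.1 x = true then true :: r.route x else false :: l.route x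

/-- `T(ℓ, h)`: the leaf `ℓ` is replaced by an inner node with splitting function `h` and two
leaves. (The tree is unchanged if `ℓ` is not the address of a leaf.) -/
def split : Tree H → Address → H → Tree H
  | leaf, [], h => node h leaf leaf
  | leaf, _ :: _, _ => leaf
  | node g l r, [], _ => node g l r
  | node g l r, false :: p, h => node g (l.split p h) r
  | node g l r, true :: p, h => node g l (r.split p h)

/-- `S_ℓ`: the examples of `S` that reach the leaf `ℓ`. -/
def dataAt (T : Tree H) (S : Dataset X) (ℓ : Address) : Dataset X :=
  S.filter fun p => T.route p.1 = ℓ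

end Tree

/-- The training error on `S` of a classifier. -/
def trainError {X : Type*} (S : Dataset X) (c : X → Bool) : ℝ :=
  ((S.filter fun p => c p.1 ≠ p.2).card : ℝ) / S.card

/-! ### The subroutine PrivateSplit -/

/-- A candidate for the subroutine PrivateSplit: a randomized algorithm, i.e. a function of random
bits from `Ω`, the data `S_ℓ` at the leaf, the privacy parameter and the failure probability,
with values in `H × ℝ`. -/
abbrev Splitter {X : Type*} (H : Set (X → Bool)) (Ω : Type*) :=
  Ω → Dataset X → ℝ → ℝ → H × ℝ

/-- The output of the subroutine is a random variable. Splitting functions carry the σ-algebra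
generated by the evaluations at the points of `X`. -/
def Splitter.IsMeasurable {X : Type*} {H : Set (X → Bool)} {Ω : Type*} [MeasurableSpace Ω]
    (PS : Splitter H Ω) : Prop :=
  ∀ S α δ, Measurable fun ω => PS ω S α δ

/-- The privacy requirement: with privacy parameter `α` the subroutine is `α`-differentially
private. -/
def Splitter.IsPrivate {X : Type*} {H : Set (X → Bool)} {Ω : Type*} [MeasurableSpace Ω]
    (PS : Splitter H Ω) (P : Measure Ω) (f : X → Bool) : Prop :=
  ∀ α δ : ℝ, 0 < α → 0 < δ → δ ≤ 1 →
    ∀ S S' : Dataset X, LabelledBy f S → LabelledBy f S' → Neighboring S S' →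
      ∀ O : Set (H × ℝ), MeasurableSet O →
        P {ω | PS ω S α δ ∈ O} ≤ ENNReal.ofReal (Real.exp α) * P {ω | PS ω S' α δ ∈ O}

/-- The output `(ĥ, Ĵ)` is accurate up to `ζ` on the data `S`:
`J(ĥ) ≥ max_h J(h) - ζ` and `|J(ĥ) - Ĵ| ≤ ζ`. -/
def Accurate {X : Type*} {H : Set (X → Bool)} (S : Dataset X) (ζ : ℝ) (out : H × ℝ) : Prop :=
  (∀ h ∈ H, J S h - ζ ≤ J S out.1.1) ∧ |J S out.1.1 - out.2| ≤ ζ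

/-- The utility requirement, with data requirement `N(ζ, α, δ)`. -/
def Splitter.IsUseful {X : Type*} {H : Set (X → Bool)} {Ω : Type*} [MeasurableSpace Ω]
    (PS : Splitter H Ω) (P : Measure Ω) (f : X → Bool) (N : ℝ → ℝ → ℝ → ℝ) : Prop :=
  ∀ ζ α δ : ℝ, 0 < ζ → 0 < α → 0 < δ → δ ≤ 1 →
    ∀ S : Dataset X, LabelledBy f S → N ζ α δ ≤ S.card →
      ENNReal.ofReal (1 - δ) ≤ P {ω | Accurate S ζ (PS ω S α δ)}

/-! ### The algorithm DP-TopDown -/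

/-- The input of DP-TopDown: the dataset, the maximal number of inner nodes, the privacy parameter,
the error, the failure probability, and the budget function of the depth. -/
structure Input (X : Type*) where
  S : Dataset X
  M : ℕ
  α : ℝ
  ε : ℝ
  δ : ℝ
  B : ℕ → ℝ

/-- An element of the priority queue: a leaf, a splitting function for it, and its priority. -/
structure Item {X : Type*} (H : Set (X → Bool)) where
  leaf : Address
  h : H
  priority : ℝ

/-- The state of the main loop: the current tree and the queue. -/
structure State {X : Type*} (H : Set (X → Bool)) where
  tree : Tree H
  queue : List (Item H)

section Algorithm

variable {X : Type*} {H : Set (X → Bool)} {Ω : Type*}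

/-- The failure probability `δ / (2 (2 M + 1))` that is handed to PrivateSplit. -/
def Input.callDelta (I : Input X) : ℝ := I.δ / (2 * (2 * I.M + 1))

/-- Initialization: a single leaf, which is put into the queue. -/
def init (PS : Splitter H Ω) (I : Input X) (ω : Ω) : State H :=
  let out := PS ω I.S (I.α / 2 * I.B 1) I.callDelta
  { tree := Tree.leaf
    queue := [⟨[], out.1, out.2⟩] }

/-- The treatment of a new leaf `ℓ` of the tree `T`; `ω` are the random bits of PrivateSplit and
`z` is a standard Laplace variable. The result is the list of (at most one) elements to be pushed
to the queue. -/
def processLeaf (PS : Splitter H Ω) (I : Input X) (T : Tree H) (ℓ : Address) (ω : Ω) (z : ℝ) :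
    List (Item H) :=
  let Sℓ := T.dataAt I.S ℓ
  let αℓ := I.α / 2 * I.B ℓ.length
  let w := (Sℓ.card : ℝ) / I.S.card + 2 / (I.S.card * αℓ) * z
  let out := PS ω Sℓ (αℓ / 2) I.callDelta
  if I.ε / I.M ≤ w then [⟨ℓ, out.1, w * out.2⟩] else []

/-- One iteration of the main loop. If the queue is empty, nothing is done. Otherwise an element of
highest priority (the first one in the queue, in case of ties) is removed from the queue, its leaf
is split, and the two new leaves are processed. -/
def step (PS : Splitter H Ω) (I : Input X) (s : State H) (r : Bool → Ω × ℝ) : State H :=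
  match s.queue.argmax Item.priority with
  | none => s
  | some e =>
    let T := s.tree.split e.leaf e.h
    { tree := T
      queue := s.queue.filter (fun e' => e'.leaf ≠ e.leaf)
        ++ processLeaf PS I T (e.leaf ++ [false]) (r false).1 (r false).2
        ++ processLeaf PS I T (e.leaf ++ [true]) (r true).1 (r true).2 }

/-- The state after `t` iterations. Initialization uses the randomness `r (0, false)`, and the
iteration `t` uses `r (t, i)` for the new leaf `ℓ_i`. -/
def stateAfter (PS : Splitter H Ω) (I : Input X) (r : ℕ × Bool → Ω × ℝ) : ℕ → State H
  | 0 => init PS I (r (0, false)).1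
  | t + 1 => step PS I (stateAfter PS I r t) fun i => r (t + 1, i)

/-- Labelling of the leaf `ℓ` of `T` by Report Noisy Max with budget `α / 2`: Laplace noise of scale
`2 / (α / 2)` is added to the number of examples of either label (a quantity of sensitivity `1`),
and the label with the larger noisy count is reported. Here `z` are standard Laplace variables. -/
def noisyLabel (I : Input X) (T : Tree H) (z : Address × Bool → ℝ) (ℓ : Address) : Bool :=
  decide ((labelCount (T.dataAt I.S ℓ) false : ℝ) + 2 / (I.α / 2) * z (ℓ, false)
    < (labelCount (T.dataAt I.S ℓ) true : ℝ) + 2 / (I.α / 2) * z (ℓ, true))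

/-- The classifier obtained by stopping the main loop after `t` iterations and labelling the leaves.
For `t = I.M` this is the output of DP-TopDown. -/
def classifierAfter (PS : Splitter H Ω) (I : Input X) (t : ℕ)
    (r : (ℕ × Bool → Ω × ℝ) × (Address × Bool → ℝ)) : X → Bool :=
  let T := (stateAfter PS I r.1 t).tree
  fun x => noisyLabel I T r.2 (T.route x)

end Algorithm

/-- The standard Laplace distribution, with density `exp (-|z|) / 2`. -/
def laplace : Measure ℝ :=
  volume.withDensity fun z => ENNReal.ofReal (Real.exp (-|z|) / 2)

/-- The law of the randomness of a run: all calls of PrivateSplit use independent random bits with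
law `P`, and all Laplace variables are independent of these and of each other. -/
def runLaw {Ω : Type*} [MeasurableSpace Ω] (P : Measure Ω) :
    Measure ((ℕ × Bool → Ω × ℝ) × (Address × Bool → ℝ)) :=
  (Measure.infinitePi fun _ => P.prod laplace).prod (Measure.infinitePi fun _ => laplace)

end DPTree

end

open MeasureTheory

noncomputable section

/-! The main loop is boosting with an entropy potential. Let Φ be the sum of |S_ℓ| G(q(S_ℓ)) over
the queued leaves and E the number of errors of the majority labels there. If S_ℓ is reweighted so
that both labels have mass 1/2, weak learning yields a splitting function correlated with the label.
Binary entropy is strongly concave, so this correlation forces mutual information, and |S_ℓ| J ≥ 4γ²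
err (`WeakLearning.exists_card_mul_J`). After k iterations the queue has at most k + 1 items, so one
of them carries a share 1/(k+1) of E. The popped item competes with it up to errors of size ζ and
lowers Φ by at least 4γ²E/(k+1) - 7ζ|S| (`QueueGood.le_card_mul_J`).

While E > (2/5)ε|S|, the loss 7ζ|S| is at most half of the gain, and Φ ≤ 7 log(2/ε) E. Hence Φ
shrinks by the factor 1 - a/(k+1) with a = 2γ²/(7 log(2/ε)), which gives Φ ≤ |S| (k+1)^(-a). As E ≤
Φ, the error in the queue falls to (2/5)ε|S| once a log t ≥ log(5/(2ε)) (`RunGood.queueSum_err_le`).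
The at most t + 1 leaves outside the queue hold little more than a fraction ε/M of the data each,
and a majority label errs on at most half of it, so they cost about ε/2
(`QueueGood.sum_err_leaves_le`). The noise of the labelling costs at most ε/40.

The data of a call depend on earlier randomness, but its own random bits are fresh. The success
events are not shown to be measurable, and lower bounds on the outer measures of two sets say
nothing about their intersection, so a union bound is not available. Instead conditional success
probabilities are multiplied, one coordinate at a time (`mul_le_infinitePi_of_forall_update`,
`ofReal_le_infinitePi_runGood`). -/

namespace DPTree

/-! ### Outer measure on product spaces and adaptive resampling -/

section OuterMeasure

/-- If all sections of `C` over `A` have outer measure at least `b`, then the outer measure of `C` is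
at least `μ A * b`. -/
theorem mul_le_prod_of_forall_section {α β : Type*} [MeasurableSpace α] [MeasurableSpace β]
    (μ : Measure α) (ν : Measure β) [SFinite ν] (A : Set α) (C : Set (α × β))
    (b : ENNReal) (h : ∀ x ∈ A, b ≤ ν (Prod.mk x ⁻¹' C)) : μ A * b ≤ μ.prod ν C := by
  -- The measurable hull has the same measure as C and larger sections, so Markov's inequality for
  -- its section function suffices.
  set D := toMeasurable (μ.prod ν) C
  have hD : MeasurableSet D := measurableSet_toMeasurable _ _
  have hm : Measurable fun x => ν (Prod.mk x ⁻¹' D) := measurable_measure_prodMk_left hD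
  have hA : A ⊆ {x | b ≤ ν (Prod.mk x ⁻¹' D)} := fun x hx =>
    (h x hx).trans (measure_mono (Set.preimage_mono (subset_toMeasurable _ _)))
  calc μ A * b ≤ b * μ {x | b ≤ ν (Prod.mk x ⁻¹' D)} := by
        rw [mul_comm]; gcongr
    _ ≤ ∫⁻ x, ν (Prod.mk x ⁻¹' D) ∂μ := mul_meas_ge_le_lintegral hm b
    _ = μ.prod ν C := by rw [← Measure.prod_apply hD, measure_toMeasurable]

theorem measurable_update_prod {ι β : Type*} [DecidableEq ι] [MeasurableSpace β] (i : ι) :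
    Measurable fun p : (ι → β) × β => Function.update p.1 i p.2 := by
  refine measurable_pi_lambda _ fun j => ?_
  by_cases hj : j = i
  · subst hj; simpa using measurable_snd
  · simp only [Function.update_of_ne hj]
    exact (measurable_pi_apply j).comp measurable_fst

/-- Replacing one coordinate by an independent copy preserves a product measure. -/
theorem infinitePi_map_update {ι β : Type*} [DecidableEq ι] [MeasurableSpace β] (ρ : Measure β)
    [IsProbabilityMeasure ρ] (i : ι) :
    ((Measure.infinitePi fun _ : ι => ρ).prod ρ).map (fun p => Function.update p.1 i p.2)
      = Measure.infinitePi fun _ : ι => ρ := by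
  have hmeas := measurable_update_prod (ι := ι) (β := β) i
  refine Measure.eq_infinitePi _ fun s t ht => ?_
  rw [Measure.map_apply hmeas (MeasurableSet.pi s.countable_toSet fun j _ => ht j)]
  by_cases hi : i ∈ s
  · have : (fun p : (ι → β) × β => Function.update p.1 i p.2) ⁻¹' (Set.pi s t)
        = (Set.pi ↑(s.erase i) t) ×ˢ (t i) := by
      ext p
      simp only [Set.mem_preimage, Set.mem_pi, Finset.mem_coe, Set.mem_prod, Finset.mem_erase]
      constructor
      · intro h
        refine ⟨fun j hj => ?_, by simpa using h i hi⟩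
        simpa [Function.update_of_ne hj.1] using h j hj.2
      · rintro ⟨h1, h2⟩ j hj
        by_cases hji : j = i
        · subst hji; simpa using h2
        · simpa [Function.update_of_ne hji] using h1 j ⟨hji, hj⟩
    rw [this, Measure.prod_prod, Measure.infinitePi_pi _ fun j _ => ht j, mul_comm,
      Finset.mul_prod_erase s (fun j => ρ (t j)) hi]
  · have : (fun p : (ι → β) × β => Function.update p.1 i p.2) ⁻¹' (Set.pi s t)
        = (Set.pi ↑s t) ×ˢ Set.univ := by
      ext p
      simp only [Set.mem_preimage, Set.mem_pi, Finset.mem_coe, Set.mem_prod, Set.mem_univ, and_true]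
      refine forall₂_congr fun j hj => ?_
      have hji : j ≠ i := fun h => hi (h ▸ hj)
      rw [Function.update_of_ne hji]
    rw [this, Measure.prod_prod, Measure.infinitePi_pi _ fun j _ => ht j, measure_univ, mul_one]

/-- Adaptive resampling: if from every point of `A` a fresh value of the coordinate `i` leads to `C`
with probability at least `b`, then `C` has probability at least `b` times that of `A`. -/
theorem mul_le_infinitePi_of_forall_update {ι β : Type*} [DecidableEq ι] [MeasurableSpace β]
    (ρ : Measure β) [IsProbabilityMeasure ρ] (i : ι) (A C : Set (ι → β)) (b : ENNReal)
    (h : ∀ r ∈ A, b ≤ ρ {y | Function.update r i y ∈ C}) :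
    Measure.infinitePi (fun _ : ι => ρ) A * b ≤ Measure.infinitePi (fun _ : ι => ρ) C := by
  have hmeas := measurable_update_prod (ι := ι) (β := β) i
  refine (mul_le_prod_of_forall_section _ ρ A
    ((fun p => Function.update p.1 i p.2) ⁻¹' C) b h).trans ?_
  -- For nonmeasurable C only this inequality between preimage and image law holds; it is the
  -- direction needed.
  exact (Measure.le_map_apply hmeas.aemeasurable C).trans_eq (by rw [infinitePi_map_update])

/-- Substitute for the union bound: failure probabilities still add up when success probabilities
are multiplied. -/
theorem ofReal_one_sub_mul_ofReal_one_sub {a b : ℝ} (ha : 0 ≤ a) (hb : 0 ≤ b) :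
    ENNReal.ofReal (1 - (a + b)) ≤ ENNReal.ofReal (1 - a) * ENNReal.ofReal (1 - b) := by
  by_cases h : 1 ≤ a + b
  · rw [ENNReal.ofReal_of_nonpos (by linarith)]; exact zero_le
  · rw [← ENNReal.ofReal_mul (by linarith)]
    exact ENNReal.ofReal_le_ofReal (by nlinarith [mul_nonneg ha hb])

/-- A finite box whose sides have probability at least `1 - p` has probability at least
`1 - card * p`. -/
theorem ofReal_one_sub_card_mul_le_infinitePi {ι β : Type*} [MeasurableSpace β]
    (ρ : Measure β) [IsProbabilityMeasure ρ] (s : Finset ι) (B : Set β) (hB : MeasurableSet B)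
    {p : ℝ} (hp : 0 ≤ p) (h : ENNReal.ofReal (1 - p) ≤ ρ B) :
    ENNReal.ofReal (1 - s.card * p) ≤ Measure.infinitePi (fun _ : ι => ρ) {r | ∀ i ∈ s, r i ∈ B} := by
  have h1 : Measure.infinitePi (fun _ : ι => ρ) {r | ∀ i ∈ s, r i ∈ B} = (ρ B) ^ s.card := by
    have he : {r : ι → β | ∀ i ∈ s, r i ∈ B} = Set.pi s fun _ => B := by ext; simp
    rw [he, Measure.infinitePi_pi _ fun _ _ => hB, Finset.prod_const]
  rw [h1]
  refine le_trans ?_ (pow_le_pow_left' h _)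
  induction s.card with
  | zero => simp
  | succ n ih =>
    rw [pow_succ]
    refine le_trans ?_ (mul_le_mul_left ih _)
    refine le_trans (le_of_eq ?_)
      (ofReal_one_sub_mul_ofReal_one_sub (a := n * p) (b := p) (by positivity) hp)
    push_cast
    ring_nf

end OuterMeasure

/-! ### Tails of the Laplace distribution -/

section Laplace

theorem lintegral_Ioi_exp_neg_abs {s : ℝ} (hs : 0 ≤ s) :
    ∫⁻ z in Set.Ioi s, ENNReal.ofReal (Real.exp (-|z|) / 2) = ENNReal.ofReal (Real.exp (-s) / 2) := by
  rw [setLIntegral_congr_fun (g := fun z => ENNReal.ofReal (Real.exp (-z) / 2)) measurableSet_Ioi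
    (fun z hz => by
      have : 0 < z := lt_of_le_of_lt hs hz
      simp only [abs_of_pos this]),
    ← ofReal_integral_eq_lintegral_ofReal ((integrableOn_exp_neg_Ioi s).div_const 2)
      (ae_of_all _ fun z => by positivity), integral_div, integral_exp_neg_Ioi]

theorem lintegral_Iic_exp_neg_abs {s : ℝ} (hs : 0 ≤ s) :
    ∫⁻ z in Set.Iic (-s), ENNReal.ofReal (Real.exp (-|z|) / 2)
      = ENNReal.ofReal (Real.exp (-s) / 2) := by
  rw [setLIntegral_congr_fun (g := fun z => ENNReal.ofReal (Real.exp z / 2)) measurableSet_Iic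
    (fun z hz => by
      have : z ≤ 0 := le_trans hz (by linarith)
      simp only [abs_of_nonpos this, neg_neg]),
    ← ofReal_integral_eq_lintegral_ofReal ((integrableOn_exp_Iic (-s)).div_const 2)
      (ae_of_all _ fun z => by positivity), integral_div, integral_exp_Iic]

instance isProbabilityMeasure_laplace : IsProbabilityMeasure laplace := by
  constructor
  rw [laplace, withDensity_apply _ MeasurableSet.univ, ← Set.Iic_union_Ioi (a := (0 : ℝ)),
    lintegral_union measurableSet_Ioi (Set.Iic_disjoint_Ioi le_rfl),
    lintegral_Ioi_exp_neg_abs le_rfl]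
  have := lintegral_Iic_exp_neg_abs (le_refl (0 : ℝ))
  rw [neg_zero] at this
  rw [this, ← ENNReal.ofReal_add (by positivity) (by positivity)]
  norm_num

theorem ofReal_one_sub_exp_le_laplace {s : ℝ} (hs : 0 ≤ s) :
    ENNReal.ofReal (1 - Real.exp (-s)) ≤ laplace {z | |z| ≤ s} := by
  have hm : MeasurableSet {z : ℝ | |z| ≤ s} := measurableSet_le measurable_abs measurable_const
  have hc : laplace {z : ℝ | |z| ≤ s}ᶜ ≤ ENNReal.ofReal (Real.exp (-s)) := by
    have hsub : {z : ℝ | |z| ≤ s}ᶜ ⊆ Set.Iic (-s) ∪ Set.Ioi s := by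
      intro z hz
      simp only [Set.mem_compl_iff, Set.mem_ofPred_eq, not_le, lt_abs] at hz
      rcases hz with h | h
      · exact Or.inr h
      · exact Or.inl (by simp only [Set.mem_Iic]; linarith)
    refine (measure_mono hsub).trans ((measure_union_le _ _).trans ?_)
    rw [laplace, withDensity_apply _ measurableSet_Ioi, withDensity_apply _ measurableSet_Iic,
      lintegral_Ioi_exp_neg_abs hs, lintegral_Iic_exp_neg_abs hs,
      ← ENNReal.ofReal_add (by positivity) (by positivity)]
    simp
  rw [ENNReal.ofReal_sub _ (Real.exp_pos _).le, ENNReal.ofReal_one]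
  have h1 := prob_add_prob_compl (μ := laplace) hm
  rw [tsub_le_iff_right, ← h1]
  gcongr

end Laplace

/-! ### Leaves and routing in decision trees -/

namespace Tree

variable {X : Type*} {H : Set (X → Bool)}

/-- The addresses of the leaves of a tree. -/
def leaves : Tree H → Finset Address
  | leaf => {[]}
  | node _ l r => l.leaves.image (List.cons false) ∪ r.leaves.image (List.cons true)

@[simp] theorem cons_mem_leaves_node (g : H) (l r : Tree H) (a : Bool) (p : Address) :
    a :: p ∈ (node g l r).leaves ↔ p ∈ (bif a then r else l).leaves := by
  cases a <;> simp [leaves]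

@[simp] theorem nil_notMem_leaves_node (g : H) (l r : Tree H) : [] ∉ (node g l r).leaves := by
  simp [leaves]

theorem route_mem_leaves (T : Tree H) (x : X) : T.route x ∈ T.leaves := by
  induction T with
  | leaf => simp [route, leaves]
  | node g l r hl hr =>
    unfold route
    split_ifs <;> simpa

/-- Leaf addresses are prefix-free, so the addresses created by a split never collide with existing
ones. -/
theorem append_singleton_notMem_leaves {T : Tree H} {ℓ : Address} (hℓ : ℓ ∈ T.leaves) (i : Bool) :
    ℓ ++ [i] ∉ T.leaves := by
  induction T generalizing ℓ with
  | leaf => simp [leaves]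
  | node g l r hl hr =>
    rcases ℓ with _ | ⟨a, p⟩
    · simp at hℓ
    · cases a <;> simp_all

theorem mem_leaves_split {T : Tree H} {ℓ : Address} (hℓ : ℓ ∈ T.leaves) (h : H) {p : Address}
    (hp : p ∈ (T.split ℓ h).leaves) : (p ∈ T.leaves ∧ p ≠ ℓ) ∨ ∃ i, p = ℓ ++ [i] := by
  induction T generalizing ℓ p with
  | leaf =>
    have : ℓ = [] := by simpa [leaves] using hℓ
    subst this
    rcases p with _ | ⟨a, p⟩
    · simp [split] at hp
    · refine Or.inr ⟨a, ?_⟩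
      cases a <;> simpa [split, leaves] using hp
  | node g l r hl hr =>
    rcases ℓ with _ | ⟨a, ℓ⟩
    · simp at hℓ
    · rcases p with _ | ⟨a', p⟩
      · cases a <;> simp [split] at hp
      · cases a <;> cases a' <;> simp [split] at hp hℓ ⊢
        · simpa using hl hℓ hp
        · exact hp
        · exact hp
        · simpa using hr hℓ hp

theorem mem_leaves_split_of_mem {T : Tree H} {ℓ : Address} (h : H) {p : Address}
    (hp : p ∈ T.leaves) (hne : p ≠ ℓ) : p ∈ (T.split ℓ h).leaves := by
  induction T generalizing ℓ p with
  | leaf =>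
    have : p = [] := by simpa [leaves] using hp
    subst this
    rcases ℓ with _ | ⟨a, ℓ⟩
    · exact absurd rfl hne
    · simpa [split] using hp
  | node g l r hl hr =>
    rcases ℓ with _ | ⟨a, ℓ⟩
    · simpa [split] using hp
    · rcases p with _ | ⟨a', p⟩
      · simp at hp
      · cases a <;> cases a' <;> simp_all [split]

theorem append_singleton_mem_leaves_split {T : Tree H} {ℓ : Address} (hℓ : ℓ ∈ T.leaves) (h : H)
    (i : Bool) : ℓ ++ [i] ∈ (T.split ℓ h).leaves := by
  induction T generalizing ℓ with
  | leaf =>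
    have : ℓ = [] := by simpa [leaves] using hℓ
    subst this
    cases i <;> simp [split, leaves]
  | node g l r hl hr =>
    rcases ℓ with _ | ⟨a, ℓ⟩
    · simp at hℓ
    · cases a <;> simp_all [split]

theorem card_leaves_split {T : Tree H} {ℓ : Address} (hℓ : ℓ ∈ T.leaves) (h : H) :
    (T.split ℓ h).leaves.card ≤ T.leaves.card + 1 := by
  have hsub : (T.split ℓ h).leaves ⊆
      insert (ℓ ++ [false]) (insert (ℓ ++ [true]) (T.leaves.erase ℓ)) := by
    intro p hp
    rcases mem_leaves_split hℓ h hp with ⟨h1, h2⟩ | ⟨i, rfl⟩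
    · simp [h1, h2]
    · cases i <;> simp
  have h1 := Finset.card_le_card hsub
  have h2 := Finset.card_insert_le (ℓ ++ [false]) (insert (ℓ ++ [true]) (T.leaves.erase ℓ))
  have h3 := Finset.card_insert_le (ℓ ++ [true]) (T.leaves.erase ℓ)
  have h4 := Finset.card_erase_add_one hℓ
  omega

theorem route_split {T : Tree H} {ℓ : Address} (hℓ : ℓ ∈ T.leaves) (h : H) (x : X) :
    (T.split ℓ h).route x = if T.route x = ℓ then ℓ ++ [h.1 x] else T.route x := by
  induction T generalizing ℓ with
  | leaf =>
    have : ℓ = [] := by simpa [leaves] using hℓ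
    subst this
    cases hx : h.1 x <;> simp [split, route, hx]
  | node g l r hl hr =>
    rcases ℓ with _ | ⟨a, ℓ⟩
    · simp at hℓ
    · cases a <;> cases hx : g.1 x <;> simp_all [split, route] <;> split_ifs <;> rfl

theorem dataAt_split_child {T : Tree H} {ℓ : Address} (hℓ : ℓ ∈ T.leaves) (h : H) (S : Dataset X)
    (i : Bool) : (T.split ℓ h).dataAt S (ℓ ++ [i]) = child (T.dataAt S ℓ) h.1 i := by
  rw [dataAt, dataAt, child, Multiset.filter_filter]
  refine Multiset.filter_congr fun p _ => ?_
  rw [route_split hℓ]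
  split_ifs with hr
  · simp [hr]
  · have : T.route p.1 ≠ ℓ ++ [i] := fun he =>
      append_singleton_notMem_leaves hℓ i (he ▸ route_mem_leaves T p.1)
    simp [hr, this]

theorem dataAt_split_of_ne {T : Tree H} {ℓ ℓ' : Address} (hℓ : ℓ ∈ T.leaves) (hℓ' : ℓ' ∈ T.leaves)
    (hne : ℓ' ≠ ℓ) (h : H) (S : Dataset X) : (T.split ℓ h).dataAt S ℓ' = T.dataAt S ℓ' := by
  refine Multiset.filter_congr fun p _ => ?_
  rw [route_split hℓ]
  split_ifs with hr
  · have : ℓ ++ [h.1 p.1] ≠ ℓ' := fun he => append_singleton_notMem_leaves hℓ _ (he ▸ hℓ')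
    simp [hr, this, hne.symm]
  · rfl

end Tree

theorem LabelledBy.mono {X : Type*} {f : X → Bool} {S S' : Dataset X} (h : LabelledBy f S)
    (hS : S' ≤ S) : LabelledBy f S' :=
  fun p hp => h p (Multiset.mem_of_le hS hp)

theorem LabelledBy.dataAt {X : Type*} {H : Set (X → Bool)} {f : X → Bool} {S : Dataset X}
    (h : LabelledBy f S) (T : Tree H) (ℓ : Address) : LabelledBy f (T.dataAt S ℓ) :=
  h.mono (Multiset.filter_le _ _)

/-- The number of examples satisfying a predicate is the sum of these numbers over the leaves. -/
theorem card_filter_eq_sum_leaves {X : Type*} {H : Set (X → Bool)} (T : Tree H) (S : Dataset X)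
    (P : X × Bool → Prop) [DecidablePred P] :
    (S.filter P).card = ∑ ℓ ∈ T.leaves, ((T.dataAt S ℓ).filter P).card := by
  induction S using Multiset.induction_on with
  | empty => simp [Tree.dataAt]
  | cons a S ih =>
    have h1 : ∀ ℓ, ((T.dataAt (a ::ₘ S) ℓ).filter P).card
        = (if T.route a.1 = ℓ then (if P a then 1 else 0) else 0)
          + ((T.dataAt S ℓ).filter P).card := by
      intro ℓ
      by_cases hr : T.route a.1 = ℓ <;> by_cases hP : P a <;>
        simp [Tree.dataAt, hr, hP, add_comm]
    simp only [h1, Finset.sum_add_distrib, Finset.sum_ite_eq, Tree.route_mem_leaves, if_true, ← ih]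
    by_cases hP : P a <;> simp [hP, add_comm]

/-! ### Inequalities for the binary entropy -/

section Entropy

open Real

/-- Unnormalized entropies become sums of `negMulLog` of the weights, which turns chain rules into
linear identities. Zero weights are covered by 0 log 0 = 0. -/
theorem add_mul_binEntropy_div {x y : ℝ} (hx : 0 ≤ x) (hy : 0 ≤ y) :
    (x + y) * binEntropy (x / (x + y)) = negMulLog x + negMulLog y - negMulLog (x + y) := by
  rcases hx.eq_or_lt with rfl | hx
  · simp
  rcases hy.eq_or_lt with rfl | hy
  · simp [hx.ne']
  have hxy : 0 < x + y := by positivity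
  have h1 : 1 - x / (x + y) = y / (x + y) := by field_simp; ring
  rw [binEntropy_eq_negMulLog_add_negMulLog_one_sub, h1]
  simp only [negMulLog]
  rw [log_div hx.ne' hxy.ne', log_div hy.ne' hxy.ne']
  field_simp
  ring

/-- The binary entropy is strongly concave: its second derivative is at most `-4`. -/
theorem concaveOn_binEntropy_add_sq :
    ConcaveOn ℝ (Set.Icc 0 1) fun x => binEntropy x + 2 * x ^ 2 := by
  have hd : ∀ x ∈ Set.Ioo (0 : ℝ) 1, HasDerivAt (fun x => binEntropy x + 2 * x ^ 2)
      (log (1 - x) - log x + 4 * x) x := by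
    intro x hx
    have := (hasDerivAt_binEntropy hx.1.ne' hx.2.ne).add (((hasDerivAt_id x).pow 2).const_mul 2)
    convert! this using 1
    simp; ring
  have hd2 : ∀ x ∈ Set.Ioo (0 : ℝ) 1, HasDerivAt (fun x => log (1 - x) - log x + 4 * x)
      (-(1 - x)⁻¹ - x⁻¹ + 4) x := by
    intro x hx
    have h1 : (1 - x) ≠ 0 := by have := hx.2; intro h; linarith
    have := ((((hasDerivAt_id x).const_sub 1).log h1).sub (hasDerivAt_log hx.1.ne')).add
      ((hasDerivAt_id x).const_mul 4)
    convert! this using 1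
    simp; ring
  refine concaveOn_of_hasDerivWithinAt2_nonpos (convex_Icc 0 1) (by fun_prop)
    (f' := fun x => log (1 - x) - log x + 4 * x) (f'' := fun x => -(1 - x)⁻¹ - x⁻¹ + 4) ?_ ?_ ?_
  · rw [interior_Icc]; exact fun x hx => (hd x hx).hasDerivWithinAt
  · rw [interior_Icc]; exact fun x hx => (hd2 x hx).hasDerivWithinAt
  · rw [interior_Icc]
    intro x hx
    have h0 := hx.1
    have h1 : 0 < 1 - x := by linarith [hx.2]
    -- The coefficient 2 of x² is the largest possible: equality holds at x = 1/2.
    have : -(1 - x)⁻¹ - x⁻¹ + 4 = -(1 - 2 * x) ^ 2 / ((1 - x) * x) := by field_simp; ring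
    rw [this]
    exact div_nonpos_of_nonpos_of_nonneg (by nlinarith [sq_nonneg (1 - 2 * x)]) (by positivity)

/-- A test that is correlated with a label has large mutual information with it. Here `a, b, c, d`
are the weights of the four combinations of label and test. -/
theorem mutualInformation_lower_bound {a b c d γ : ℝ} (ha : 0 ≤ a) (hb : 0 ≤ b) (hc : 0 ≤ c)
    (hd : 0 ≤ d) (hγ : 0 ≤ γ) (h1 : 0 < a + b) (h0 : 0 < c + d)
    (hcor : (c + d) * b + (a + b) * c ≤ (1 - 2 * γ) * ((c + d) * (a + b))) :
    8 * γ ^ 2 * ((a + b) * (c + d) / (a + b + (c + d))) ≤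
      (a + b + (c + d)) * binEntropy ((a + b) / (a + b + (c + d)))
        - (a + c) * binEntropy (a / (a + c)) - (b + d) * binEntropy (b / (b + d)) := by
  have hn : 0 < a + b + (c + d) := by positivity
  set n := a + b + (c + d) with hndef
  -- Symmetry of mutual information. Conditioning on the label instead of the test makes the
  -- correlation hypothesis a statement about the two conditional means.
  have htr : n * binEntropy ((a + b) / n)
        - (a + c) * binEntropy (a / (a + c)) - (b + d) * binEntropy (b / (b + d))
      = n * binEntropy ((a + c) / n) - (a + b) * binEntropy (a / (a + b))
        - (c + d) * binEntropy (c / (c + d)) := by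
    have e1 := add_mul_binEntropy_div (x := a + b) (y := c + d) h1.le h0.le
    have e2 := add_mul_binEntropy_div (x := a + c) (y := b + d) (by positivity) (by positivity)
    have e3 : a + c + (b + d) = n := by rw [hndef]; ring
    rw [e3] at e2
    rw [e1, e2, add_mul_binEntropy_div ha hc, add_mul_binEntropy_div hb hd,
      add_mul_binEntropy_div ha hb, add_mul_binEntropy_div hc hd]
    ring
  rw [htr]
  have hx : a / (a + b) ∈ Set.Icc (0 : ℝ) 1 :=
    ⟨by positivity, (div_le_one h1).2 (by linarith)⟩
  have hy : c / (c + d) ∈ Set.Icc (0 : ℝ) 1 :=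
    ⟨by positivity, (div_le_one h0).2 (by linarith)⟩
  have hconc := concaveOn_binEntropy_add_sq.2 hx hy (show 0 ≤ (a + b) / n by positivity)
    (show 0 ≤ (c + d) / n by positivity) (by rw [← add_div, div_self hn.ne'])
  simp only [smul_eq_mul] at hconc
  have hmix : (a + b) / n * (a / (a + b)) + (c + d) / n * (c / (c + d)) = (a + c) / n := by
    field_simp
  rw [hmix] at hconc
  -- The hypothesis divided by (a+b)(c+d) reads b/(a+b) + c/(c+d) ≤ 1 - 2γ.
  have hdiff : 2 * γ ≤ a / (a + b) - c / (c + d) := by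
    rw [div_sub_div _ _ h1.ne' h0.ne', le_div_iff₀ (by positivity)]
    nlinarith
  have hsq : 4 * γ ^ 2 ≤ (a / (a + b) - c / (c + d)) ^ 2 := by nlinarith
  -- The gap in Jensen's inequality is at least twice the variance of the conditional mean, and this
  -- variance is computed here.
  have hvar : (a + b) * (a / (a + b)) ^ 2 + (c + d) * (c / (c + d)) ^ 2 - n * ((a + c) / n) ^ 2
      = (a + b) * (c + d) / n * (a / (a + b) - c / (c + d)) ^ 2 := by
    rw [← hmix]
    generalize a / (a + b) = u
    generalize c / (c + d) = v
    field_simp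
    rw [hndef]
    ring
  have hmul := mul_le_mul_of_nonneg_left hconc hn.le
  have hexp : n * ((a + b) / n * (binEntropy (a / (a + b)) + 2 * (a / (a + b)) ^ 2)
      + (c + d) / n * (binEntropy (c / (c + d)) + 2 * (c / (c + d)) ^ 2))
      = (a + b) * (binEntropy (a / (a + b)) + 2 * (a / (a + b)) ^ 2)
      + (c + d) * (binEntropy (c / (c + d)) + 2 * (c / (c + d)) ^ 2) := by
    field_simp
  rw [hexp] at hmul
  have hlast := mul_le_mul_of_nonneg_left hsq
    (show 0 ≤ (a + b) * (c + d) / n by positivity)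
  nlinarith

/-- For x ≤ 1/2 the term -x log x alone is at least x log 2; the other half follows by symmetry. -/
theorem min_le_binEntropy_div_log_two {x : ℝ} (h0 : 0 ≤ x) (h1 : x ≤ 1) :
    min x (1 - x) ≤ binEntropy x / log 2 := by
  wlog hx : x ≤ 1 / 2 generalizing x
  · have := this (x := 1 - x) (by linarith) (by linarith) (by linarith)
    rwa [binEntropy_one_sub, sub_sub_cancel, min_comm] at this
  rw [le_div_iff₀ (log_pos one_lt_two)]
  rcases h0.eq_or_lt with rfl | h0
  · simp
  have h2 : log x ≤ -log 2 := by
    rw [← log_inv]; exact log_le_log h0 (by linarith)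
  have h3 : log (1 - x) ≤ 0 := log_nonpos (by linarith) (by linarith)
  rw [binEntropy_eq_negMulLog_add_negMulLog_one_sub]
  simp only [negMulLog]
  have h4 : min x (1 - x) * log 2 ≤ x * log 2 :=
    mul_le_mul_of_nonneg_right (min_le_left _ _) (log_pos one_lt_two).le
  nlinarith

/-- Reverse comparison. Entropy is not linearly bounded by the error near 0; the additive θ cuts the
logarithm off at log(1/θ), by log u ≤ u - 1 with u = θ/x. -/
theorem binEntropy_le_min {x θ : ℝ} (h0 : 0 ≤ x) (h1 : x ≤ 1) (hθ : 0 < θ) :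
    binEntropy x ≤ min x (1 - x) * (log (1 / θ) + 1) + θ := by
  wlog hx : x ≤ 1 / 2 generalizing x
  · have := this (x := 1 - x) (by linarith) (by linarith) (by linarith)
    rwa [binEntropy_one_sub, sub_sub_cancel, min_comm] at this
  rw [min_eq_left (by linarith)]
  rcases h0.eq_or_lt with rfl | h0
  · simp [hθ.le]
  have h2 : log (θ / x) ≤ θ / x - 1 := log_le_sub_one_of_pos (by positivity)
  rw [log_div hθ.ne' h0.ne'] at h2
  have h3 : log (1 - x)⁻¹ ≤ (1 - x)⁻¹ - 1 :=
    log_le_sub_one_of_pos (inv_pos.2 (by linarith))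
  rw [log_inv] at h3
  have h4 := mul_le_mul_of_nonneg_left h2 h0.le
  have h5 := mul_le_mul_of_nonneg_left h3 (show 0 ≤ 1 - x by linarith)
  have h6 : x * (θ / x - 1) = θ - x := by field_simp
  have h7 : (1 - x) * ((1 - x)⁻¹ - 1) = x := by
    have : 1 - x ≠ 0 := by intro h; linarith
    field_simp; ring
  rw [binEntropy_eq_negMulLog_add_negMulLog_one_sub]
  simp only [negMulLog, one_div, log_inv]
  nlinarith

end Entropy

/-! ### Entropy and majority error of a dataset -/

section Datasets

variable {X : Type*}

/-- The entropy of the labels of `S`, times the size of `S`. -/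
def ent (S : Dataset X) : ℝ := S.card * G (q S)

/-- The number of errors of the majority label on `S`. -/
def err (S : Dataset X) : ℝ := min (labelCount S false) (labelCount S true)

theorem labelCount_add (S : Dataset X) :
    (labelCount S false : ℝ) + labelCount S true = S.card := by
  have h := congrArg Multiset.card (Multiset.filter_add_not (fun p : X × Bool => p.2 = true) S)
  rw [Multiset.card_add] at h
  have h2 : S.filter (fun p : X × Bool => ¬p.2 = true) = S.filter fun p => p.2 = false :=
    Multiset.filter_congr fun p _ => by simp
  rw [h2] at h
  unfold labelCount
  rw [← h]; push_cast; ring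

theorem card_child_add (S : Dataset X) (h : X → Bool) :
    ((child S h false).card : ℝ) + (child S h true).card = S.card := by
  have e := congrArg Multiset.card (Multiset.filter_add_not (fun p : X × Bool => h p.1 = true) S)
  rw [Multiset.card_add] at e
  have h2 : S.filter (fun p : X × Bool => ¬h p.1 = true) = S.filter fun p => h p.1 = false :=
    Multiset.filter_congr fun p _ => by simp
  rw [h2] at e
  unfold child
  rw [← e]; push_cast; ring

theorem labelCount_child_add (S : Dataset X) (h : X → Bool) (y : Bool) :
    (labelCount (child S h false) y : ℝ) + labelCount (child S h true) y = labelCount S y := by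
  have e := card_child_add (S.filter fun p => p.2 = y) h
  simp only [labelCount, child] at e ⊢
  rw [← e, Multiset.filter_comm, Multiset.filter_comm (fun p : X × Bool => p.2 = y)
    (fun p : X × Bool => h p.1 = true)]

theorem q_nonneg (S : Dataset X) : 0 ≤ q S := by unfold q; positivity

theorem q_le_one (S : Dataset X) : q S ≤ 1 := by
  refine div_le_one_of_le₀ ?_ (by positivity)
  have := labelCount_add S
  have h : (0 : ℝ) ≤ labelCount S false := by positivity
  linarith

theorem G_nonneg {x : ℝ} (h0 : 0 ≤ x) (h1 : x ≤ 1) : 0 ≤ G x :=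
  div_nonneg (Real.binEntropy_nonneg h0 h1) (Real.log_pos one_lt_two).le

theorem G_le_one (x : ℝ) : G x ≤ 1 :=
  div_le_one_of_le₀ Real.binEntropy_le_log_two (Real.log_pos one_lt_two).le

theorem ent_nonneg (S : Dataset X) : 0 ≤ ent S :=
  mul_nonneg (by positivity) (G_nonneg (q_nonneg S) (q_le_one S))

theorem ent_le_card (S : Dataset X) : ent S ≤ S.card :=
  mul_le_of_le_one_right (by positivity) (G_le_one _)

theorem err_nonneg (S : Dataset X) : 0 ≤ err S := le_min (by positivity) (by positivity)

theorem two_mul_err_le_card (S : Dataset X) : 2 * err S ≤ S.card := by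
  rw [← labelCount_add S, two_mul]
  exact add_le_add (min_le_left _ _) (min_le_right _ _)

/-- A minimum of sums dominates the sum of minima. This makes the error in the queue monotone along
the run. -/
theorem err_child_add_le (S : Dataset X) (h : X → Bool) :
    err (child S h false) + err (child S h true) ≤ err S := by
  unfold err
  rw [← labelCount_child_add S h false, ← labelCount_child_add S h true]
  exact le_min (add_le_add (min_le_left _ _) (min_le_left _ _))
    (add_le_add (min_le_right _ _) (min_le_right _ _))

/-- Weighted by the size of the data, the criterion is exactly the decrease of the potential under
the split. -/
theorem card_mul_J (S : Dataset X) (h : X → Bool) :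
    S.card * J S h = ent S - ent (child S h false) - ent (child S h true) := by
  by_cases hS : (S.card : ℝ) = 0
  · have h0 : S = 0 := by simpa using hS
    subst h0
    simp [ent, child]
  · unfold J ent
    field_simp

theorem abs_J_le_one (S : Dataset X) (h : X → Bool) : |J S h| ≤ 1 := by
  have h0 := G_nonneg (q_nonneg S) (q_le_one S)
  have h1 := G_le_one (q S)
  have g := fun i => G_nonneg (q_nonneg (child S h i)) (q_le_one (child S h i))
  have g' := fun i => G_le_one (q (child S h i))
  have w : ∀ i, (0 : ℝ) ≤ (child S h i).card / S.card := fun i => by positivity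
  have hs : ((child S h false).card : ℝ) / S.card + (child S h true).card / S.card ≤ 1 := by
    rw [← add_div, card_child_add]
    exact div_self_le_one _
  have a0 := mul_nonneg (w false) (g false)
  have a1 := mul_nonneg (w true) (g true)
  have b0 := mul_le_of_le_one_right (w false) (g' false)
  have b1 := mul_le_of_le_one_right (w true) (g' true)
  rw [abs_le]
  unfold J
  constructor <;> linarith

theorem err_eq_card_mul_min (S : Dataset X) : err S = S.card * min (q S) (1 - q S) := by
  by_cases hS : (S.card : ℝ) = 0
  · have h0 : S = 0 := by simpa using hS
    subst h0
    simp [err, labelCount]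
  · rw [mul_min_of_nonneg _ _ (by positivity), min_comm, err]
    have := labelCount_add S
    congr 1
    · unfold q; field_simp; linarith
    · unfold q; field_simp

theorem err_le_ent (S : Dataset X) : err S ≤ ent S := by
  rw [err_eq_card_mul_min]
  exact mul_le_mul_of_nonneg_left (min_le_binEntropy_div_log_two (q_nonneg S) (q_le_one S))
    (by positivity)

theorem ent_mul_log_two_le (S : Dataset X) {θ : ℝ} (hθ : 0 < θ) :
    ent S * Real.log 2 ≤ err S * (Real.log (1 / θ) + 1) + θ * S.card := by
  have h := mul_le_mul_of_nonneg_left (binEntropy_le_min (q_nonneg S) (q_le_one S) hθ)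
    (show (0 : ℝ) ≤ S.card by positivity)
  have h2 : Real.log 2 ≠ 0 := (Real.log_pos one_lt_two).ne'
  rw [err_eq_card_mul_min, ent, G, mul_assoc, div_mul_cancel₀ _ h2]
  linarith

end Datasets

/-! ### From weak learning to a decrease of entropy -/

section WeakLearning

variable {X : Type*}

theorem ofMultiset_toOuterMeasure_toReal (s : Multiset X) (hs : s ≠ 0) (p : X → Prop)
    [DecidablePred p] :
    ((PMF.ofMultiset s hs).toOuterMeasure {x | p x}).toReal = (s.filter p).card / s.card := by
  classical
  have h1 : ∑' x, ((s.filter p).count x : ENNReal) = (s.filter p).card := by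
    rw [tsum_eq_sum (s := (s.filter p).toFinset)]
    · rw [← Multiset.toFinset_sum_count_eq (s.filter p)]
      push_cast
      rfl
    · intro x hx
      simpa using hx
  have h2 := PMF.toOuterMeasure_ofMultiset_apply hs {x | p x}
  simp only [Set.mem_ofPred_eq] at h2
  rw [h2, ENNReal.toReal_div, ← ENNReal.toReal_natCast (s.filter p).card, ← h1]
  simp only [ENNReal.toReal_natCast]

/-- An error probability is nonnegative. The resulting γ² ≤ 1/4 enters the numerical estimates. -/
theorem WeakLearning.advantage_le_half {H : Set (X → Bool)} {f : X → Bool} {γ : ℝ}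
    (hW : WeakLearning H f γ) [Nonempty X] : γ ≤ 1 / 2 := by
  obtain ⟨h, -, hh⟩ := hW (PMF.pure (Classical.arbitrary X))
  have := hh.trans' ENNReal.toReal_nonneg
  linarith

/-- Weak learning for the distribution that gives weight `1/2` to either label. -/
theorem WeakLearning.exists_balanced {H : Set (X → Bool)} {f : X → Bool} {γ : ℝ}
    (hW : WeakLearning H f γ) {S : Dataset X} (hS : LabelledBy f S)
    (h0 : labelCount S false ≠ 0) (h1 : labelCount S true ≠ 0) :
    ∃ h ∈ H, (labelCount S false : ℝ) * labelCount (child S h false) true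
        + labelCount S true * labelCount (child S h true) false
      ≤ (1 - 2 * γ) * (labelCount S false * labelCount S true) := by
  -- Every example is repeated as often as the opposite label occurs, so both labels end up with the
  -- same number of copies.
  set D : Multiset (X × Bool) := labelCount S false • (S.filter fun p => p.2 = true)
    + labelCount S true • (S.filter fun p => p.2 = false) with hD
  have hcard : D.card = 2 * (labelCount S false * labelCount S true) := by
    simp only [hD, Multiset.card_add, Multiset.card_nsmul]
    simp only [labelCount]
    ring
  have hne : D.map Prod.fst ≠ 0 := by
    intro h
    have : D.card = 0 := by simpa using congrArg Multiset.card h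
    rw [hcard] at this
    simp [h0, h1] at this
  obtain ⟨h, hH, hle⟩ := hW (PMF.ofMultiset _ hne)
  refine ⟨h, hH, ?_⟩
  rw [ofMultiset_toOuterMeasure_toReal, Multiset.card_map, Multiset.filter_map, Multiset.card_map,
    hcard] at hle
  have hfilt : (D.filter ((fun x => h x ≠ f x) ∘ Prod.fst)).card
      = labelCount S false * labelCount (child S h false) true
        + labelCount S true * labelCount (child S h true) false := by
    simp only [hD, Multiset.filter_add, Multiset.filter_nsmul, Multiset.card_add,
      Multiset.card_nsmul, labelCount, child, Multiset.filter_filter]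
    have g1 : S.filter (fun p : X × Bool => ((fun x => h x ≠ f x) ∘ Prod.fst) p ∧ p.2 = true)
        = S.filter fun p => p.2 = true ∧ h p.1 = false := by
      refine Multiset.filter_congr fun p hp => ?_
      have := hS p hp
      cases hx : h p.1 <;> cases hy : f p.1 <;> simp [this, hx, hy]
    have g2 : S.filter (fun p : X × Bool => ((fun x => h x ≠ f x) ∘ Prod.fst) p ∧ p.2 = false)
        = S.filter fun p => p.2 = false ∧ h p.1 = true := by
      refine Multiset.filter_congr fun p hp => ?_
      have := hS p hp
      cases hx : h p.1 <;> cases hy : f p.1 <;> simp [this, hx, hy]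
    rw [g1, g2]
  rw [hfilt, div_le_iff₀ (by positivity)] at hle
  push_cast at hle
  linarith

/-- A weak learner finds a splitting function with a large decrease of entropy. -/
theorem WeakLearning.exists_card_mul_J {H : Set (X → Bool)} {f : X → Bool} {γ : ℝ}
    (hW : WeakLearning H f γ) (hγ : 0 ≤ γ) {S : Dataset X} (hS : LabelledBy f S)
    (herr : 0 < err S) : ∃ h ∈ H, 4 * γ ^ 2 * err S ≤ S.card * J S h := by
  have hp0 : (0 : ℝ) < labelCount S false := lt_of_lt_of_le herr (min_le_left _ _)
  have hp1 : (0 : ℝ) < labelCount S true := lt_of_lt_of_le herr (min_le_right _ _)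
  obtain ⟨h, hH, hb⟩ := hW.exists_balanced hS (by exact_mod_cast hp0.ne') (by exact_mod_cast hp1.ne')
  refine ⟨h, hH, ?_⟩
  have e0 := labelCount_child_add S h false
  have e1 := labelCount_child_add S h true
  have key := mutualInformation_lower_bound (a := labelCount (child S h true) true)
    (b := labelCount (child S h false) true) (c := labelCount (child S h true) false)
    (d := labelCount (child S h false) false) (γ := γ) (by positivity) (by positivity)
    (by positivity) (by positivity) hγ (by linarith) (by linarith)
    (by rw [add_comm _ (labelCount (child S h false) true : ℝ), e1,
          add_comm _ (labelCount (child S h false) false : ℝ), e0]; exact hb)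
  rw [add_comm _ (labelCount (child S h false) true : ℝ), e1,
    add_comm _ (labelCount (child S h false) false : ℝ), e0,
    add_comm (labelCount S true : ℝ), labelCount_add,
    add_comm (labelCount (child S h true) true : ℝ), labelCount_add,
    add_comm (labelCount (child S h false) true : ℝ), labelCount_add] at key
  have hl2 : 0 < Real.log 2 := Real.log_pos one_lt_two
  have hl2' : Real.log 2 ≤ 1 := Real.log_two_lt_d9.le.trans (by norm_num)
  have hJ : S.card * J S h * Real.log 2 = S.card * Real.binEntropy (labelCount S true / S.card)
      - (child S h true).card
        * Real.binEntropy (labelCount (child S h true) true / (child S h true).card)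
      - (child S h false).card
        * Real.binEntropy (labelCount (child S h false) true / (child S h false).card) := by
    rw [card_mul_J]
    simp only [ent, G, q]
    field_simp
    ring
  rw [← hJ] at key
  have hn : (0 : ℝ) < S.card := by rw [← labelCount_add]; positivity
  -- The more frequent label makes up at least half of S; this turns the constant 8 into 4.
  have hhalf : err S / 2 ≤ labelCount S true * labelCount S false / S.card := by
    rw [le_div_iff₀ hn, ← labelCount_add, err]
    rcases le_total (labelCount S false : ℝ) (labelCount S true) with hle | hle
    · rw [min_eq_left hle]; nlinarith
    · rw [min_eq_right hle]; nlinarith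
  have hpos : 4 * γ ^ 2 * err S ≤ S.card * J S h * Real.log 2 := by
    refine le_trans ?_ key
    nlinarith [sq_nonneg γ]
  -- Nonnegativity is needed to drop the factor log 2 ≤ 1.
  have hnn : 0 ≤ S.card * J S h := by
    by_contra hneg
    have : S.card * J S h * Real.log 2 < 0 := mul_neg_of_neg_of_pos (not_le.1 hneg) hl2
    nlinarith [mul_nonneg (sq_nonneg γ) herr.le]
  nlinarith

end WeakLearning

/-! ### Deterministic invariants of the main loop -/

section Run

variable {X : Type*} {H : Set (X → Bool)} {Ω : Type*}

theorem step_of_argmax_eq_none (PS : Splitter H Ω) (I : Input X) {st : State H}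
    (y : Bool → Ω × ℝ) (he : st.queue.argmax Item.priority = none) : step PS I st y = st := by
  simp [step, he]

theorem step_of_argmax_eq_some (PS : Splitter H Ω) (I : Input X) {st : State H} {e : Item H}
    (y : Bool → Ω × ℝ) (he : st.queue.argmax Item.priority = some e) :
    step PS I st y =
      { tree := st.tree.split e.leaf e.h
        queue := st.queue.filter (fun e' => e'.leaf ≠ e.leaf)
          ++ processLeaf PS I (st.tree.split e.leaf e.h) (e.leaf ++ [false]) (y false).1 (y false).2
          ++ processLeaf PS I (st.tree.split e.leaf e.h) (e.leaf ++ [true]) (y true).1 (y true).2 } := by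
  simp [step, he]

theorem leaf_eq_of_mem_processLeaf {PS : Splitter H Ω} {I : Input X} {T : Tree H} {ℓ : Address}
    {ω : Ω} {z : ℝ} {e : Item H} (he : e ∈ processLeaf PS I T ℓ ω z) : e.leaf = ℓ := by
  unfold processLeaf at he
  simp only at he
  split_ifs at he
  · rw [List.mem_singleton] at he
    rw [he]
  · simp at he

theorem length_processLeaf_le (PS : Splitter H Ω) (I : Input X) (T : Tree H) (ℓ : Address)
    (ω : Ω) (z : ℝ) : (processLeaf PS I T ℓ ω z).length ≤ 1 := by
  unfold processLeaf
  simp only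
  split_ifs <;> simp

/-- Membership in the queue after splitting the leaf of the item `e`. -/
theorem mem_queue_step {PS : Splitter H Ω} {I : Input X} {st : State H} {e e' : Item H}
    {y : Bool → Ω × ℝ} (he : st.queue.argmax Item.priority = some e) :
    e' ∈ (step PS I st y).queue ↔ (e' ∈ st.queue ∧ e'.leaf ≠ e.leaf) ∨
      ∃ i, e' ∈ processLeaf PS I (st.tree.split e.leaf e.h) (e.leaf ++ [i]) (y i).1 (y i).2 := by
  rw [step_of_argmax_eq_some PS I y he]
  simp

/-- Properties of the state after `k` iterations that hold for all outcomes of the randomness. -/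
structure WellFormed (k : ℕ) (st : State H) : Prop where
  mem_leaves : ∀ e ∈ st.queue, e.leaf ∈ st.tree.leaves
  card_leaves : st.tree.leaves.card ≤ k + 1
  length_queue : st.queue.length ≤ k + 1
  depth : ∀ ℓ ∈ st.tree.leaves, ℓ.length ≤ k

theorem wellFormed_init (PS : Splitter H Ω) (I : Input X) (ω : Ω) :
    WellFormed 0 (init PS I ω) := by
  constructor <;> simp [init, Tree.leaves]

theorem WellFormed.step {k : ℕ} {st : State H} (hw : WellFormed k st) (PS : Splitter H Ω)
    (I : Input X) (y : Bool → Ω × ℝ) : WellFormed (k + 1) (step PS I st y) := by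
  rcases he : st.queue.argmax Item.priority with _ | e
  · rw [step_of_argmax_eq_none PS I y he]
    exact ⟨hw.mem_leaves, hw.card_leaves.trans (by omega), hw.length_queue.trans (by omega),
      fun ℓ hℓ => (hw.depth ℓ hℓ).trans (by omega)⟩
  have heq : e ∈ st.queue := List.argmax_mem he
  have hℓ := hw.mem_leaves e heq
  refine ⟨fun e' he' => ?_, ?_, ?_, ?_⟩
  · have htree : (DPTree.step PS I st y).tree = st.tree.split e.leaf e.h := by
      rw [step_of_argmax_eq_some PS I y he]
    rw [htree]
    rcases (mem_queue_step he).1 he' with ⟨h1, h2⟩ | ⟨i, hi⟩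
    · exact Tree.mem_leaves_split_of_mem _ (hw.mem_leaves e' h1) h2
    · rw [leaf_eq_of_mem_processLeaf hi]
      exact Tree.append_singleton_mem_leaves_split hℓ _ i
  · rw [step_of_argmax_eq_some PS I y he]
    exact (Tree.card_leaves_split hℓ _).trans (by have := hw.card_leaves; omega)
  · rw [step_of_argmax_eq_some PS I y he]
    -- At least the popped item disappears and at most two are pushed, so the length grows by at
    -- most one.
    have h1 : (st.queue.filter fun e' => e'.leaf ≠ e.leaf).length < st.queue.length :=
      List.length_filter_lt_length_iff_exists.2 ⟨e, heq, by simp⟩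
    have h2 := length_processLeaf_le PS I (st.tree.split e.leaf e.h) (e.leaf ++ [false])
      (y false).1 (y false).2
    have h3 := length_processLeaf_le PS I (st.tree.split e.leaf e.h) (e.leaf ++ [true])
      (y true).1 (y true).2
    have := hw.length_queue
    simp only [List.length_append]
    omega
  · rw [step_of_argmax_eq_some PS I y he]
    intro p hp
    rcases Tree.mem_leaves_split hℓ _ hp with ⟨h1, -⟩ | ⟨i, rfl⟩
    · exact (hw.depth p h1).trans (by omega)
    · have := hw.depth _ hℓ
      simpa using this

theorem wellFormed_stateAfter (PS : Splitter H Ω) (I : Input X) (r : ℕ × Bool → Ω × ℝ) (k : ℕ) :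
    WellFormed k (stateAfter PS I r k) := by
  induction k with
  | zero => exact wellFormed_init _ _ _
  | succ k ih => exact ih.step _ _ _

/-- The state after `t` iterations depends only on the randomness of these iterations. -/
theorem stateAfter_congr (PS : Splitter H Ω) (I : Input X) {r r' : ℕ × Bool → Ω × ℝ} {t : ℕ}
    (h : ∀ k ≤ t, ∀ i, r (k, i) = r' (k, i)) : stateAfter PS I r t = stateAfter PS I r' t := by
  induction t with
  | zero => simp [stateAfter, h 0 le_rfl]
  | succ t ih =>
    simp only [stateAfter]
    rw [ih fun k hk => h k (by omega)]
    congr 1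
    funext i
    exact h (t + 1) le_rfl i

/-- The sum over the queue of a function of the data at the leaves. -/
def queueSum (F : Dataset X → ℝ) (S : Dataset X) (st : State H) : ℝ :=
  (st.queue.map fun e => F (st.tree.dataAt S e.leaf)).sum

/-- Only an inequality, since the filter may remove several items: distinctness of the queued leaves
is not part of the invariants. -/
theorem add_sum_map_filter_le {α : Type*} (l : List α) (g : α → ℝ) (hg : ∀ a, 0 ≤ g a)
    (p : α → Bool) {a : α} (ha : a ∈ l) (hp : p a = false) :
    g a + ((l.filter p).map g).sum ≤ (l.map g).sum := by
  induction l with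
  | nil => simp at ha
  | cons b l ih =>
    have hle : ((l.filter p).map g).sum ≤ (l.map g).sum := by
      clear ih ha
      induction l with
      | nil => simp
      | cons c l ih =>
        by_cases hc : p c = true
        · simpa [List.filter_cons, hc] using ih
        · simp only [List.filter_cons, hc, List.map_cons, List.sum_cons]
          exact ih.trans (le_add_of_nonneg_left (hg c))
    rcases List.mem_cons.1 ha with rfl | h
    · simpa [List.filter_cons, hp] using hle
    · have := ih h
      by_cases hb : p b = true
      · simp only [List.filter_cons, hb, if_true, List.map_cons, List.sum_cons]
        linarith
      · simp only [List.filter_cons, hb, List.map_cons, List.sum_cons]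
        have := hg b
        simp only [Bool.false_eq_true, if_false]
        linarith

/-- Children that are not pushed can only lower the sum, because F is nonnegative. With F = `ent`
the change is at most minus the quantity in `card_mul_J`. -/
theorem queueSum_step_le (PS : Splitter H Ω) (I : Input X) {F : Dataset X → ℝ}
    (hF : ∀ S, 0 ≤ F S) {k : ℕ} {st : State H} (hw : WellFormed k st) (S : Dataset X) {e : Item H}
    (y : Bool → Ω × ℝ) (he : st.queue.argmax Item.priority = some e) :
    queueSum F S (step PS I st y) ≤ queueSum F S st - F (st.tree.dataAt S e.leaf)
      + F (child (st.tree.dataAt S e.leaf) e.h.1 false)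
      + F (child (st.tree.dataAt S e.leaf) e.h.1 true) := by
  have heq : e ∈ st.queue := List.argmax_mem he
  have hℓ := hw.mem_leaves e heq
  have hproc : ∀ i, ((processLeaf PS I (st.tree.split e.leaf e.h) (e.leaf ++ [i]) (y i).1
      (y i).2).map fun e' => F ((st.tree.split e.leaf e.h).dataAt S e'.leaf)).sum
      ≤ F (child (st.tree.dataAt S e.leaf) e.h.1 i) := by
    intro i
    rw [← Tree.dataAt_split_child hℓ e.h S i]
    unfold processLeaf
    simp only
    split_ifs
    · simp
    · simpa using hF _
  have hrest : (st.queue.filter fun e' => e'.leaf ≠ e.leaf).map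
      (fun e' => F ((st.tree.split e.leaf e.h).dataAt S e'.leaf))
      = (st.queue.filter fun e' => e'.leaf ≠ e.leaf).map
      fun e' => F (st.tree.dataAt S e'.leaf) := by
    refine List.map_congr_left fun e' he' => ?_
    obtain ⟨h1, h2⟩ := List.mem_filter.1 he'
    rw [Tree.dataAt_split_of_ne hℓ (hw.mem_leaves e' h1) (by simpa using h2)]
  have hfil := add_sum_map_filter_le st.queue (fun e' => F (st.tree.dataAt S e'.leaf))
    (fun _ => hF _) (fun e' => decide (e'.leaf ≠ e.leaf)) heq (by simp)
  have h0 := hproc false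
  have h1 := hproc true
  rw [step_of_argmax_eq_some PS I y he]
  simp only [queueSum, List.map_append, List.sum_append]
  rw [hrest]
  linarith

theorem queueSum_step_le_self (PS : Splitter H Ω) (I : Input X) {F : Dataset X → ℝ}
    (hF : ∀ S, 0 ≤ F S) (hF' : ∀ S h, F (child S h false) + F (child S h true) ≤ F S)
    {k : ℕ} {st : State H} (hw : WellFormed k st) (S : Dataset X) (y : Bool → Ω × ℝ) :
    queueSum F S (step PS I st y) ≤ queueSum F S st := by
  rcases he : st.queue.argmax Item.priority with _ | e
  · rw [step_of_argmax_eq_none PS I y he]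
  · have := queueSum_step_le PS I hF hw S y he
    have := hF' (st.tree.dataAt S e.leaf) e.h.1
    linarith

/-- Used for the error, so that a large error at time t was large at all earlier times, and for the
size, so that the queue never holds more than |S| examples. -/
theorem queueSum_stateAfter_antitone (PS : Splitter H Ω) (I : Input X) {F : Dataset X → ℝ}
    (hF : ∀ S, 0 ≤ F S) (hF' : ∀ S h, F (child S h false) + F (child S h true) ≤ F S)
    (S : Dataset X) (r : ℕ × Bool → Ω × ℝ) :
    Antitone fun k => queueSum F S (stateAfter PS I r k) :=
  antitone_nat_of_succ_le fun k =>
    queueSum_step_le_self PS I hF hF' (wellFormed_stateAfter PS I r k) S _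

theorem queueSum_init (PS : Splitter H Ω) (I : Input X) (F : Dataset X → ℝ) (S : Dataset X)
    (ω : Ω) : queueSum F S (init PS I ω) = F S := by
  simp [queueSum, init, Tree.dataAt, Tree.route]

theorem queueSum_card_le (PS : Splitter H Ω) (I : Input X) (S : Dataset X)
    (r : ℕ × Bool → Ω × ℝ) (k : ℕ) :
    queueSum (fun D => (D.card : ℝ)) S (stateAfter PS I r k) ≤ S.card := by
  have := queueSum_stateAfter_antitone PS I (F := fun D => (D.card : ℝ)) (fun _ => by positivity)
    (fun S h => (card_child_add S h).le) S r (Nat.zero_le k)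
  exact this.trans_eq (queueSum_init PS I _ S _)

/-- The total entropy in the queue is bounded by the total error in the queue. -/
theorem queueSum_ent_mul_log_two_le (S : Dataset X) (st : State H) {θ : ℝ} (hθ : 0 < θ) :
    queueSum ent S st * Real.log 2 ≤ queueSum err S st * (Real.log (1 / θ) + 1)
      + θ * queueSum (fun D => (D.card : ℝ)) S st := by
  unfold queueSum
  induction st.queue with
  | nil => simp
  | cons e l ih =>
    have := ent_mul_log_two_le (st.tree.dataAt S e.leaf) hθ
    simp only [List.map_cons, List.sum_cons]
    linarith

theorem queueSum_mono {F F' : Dataset X → ℝ} (h : ∀ D, F D ≤ F' D) (S : Dataset X)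
    (st : State H) : queueSum F S st ≤ queueSum F' S st :=
  List.sum_le_sum fun _ _ => h _

end Run

/-! ### Successful runs: probability and consequences -/

section Good

variable {X : Type*} {H : Set (X → Bool)} {Ω : Type*}

/-- The treatment of the new leaf `ℓ` of `T` succeeds: the Laplace noise is at most `s`, and
PrivateSplit is accurate up to `ζ` if at least `n` examples reach the leaf. -/
def CallGood (PS : Splitter H Ω) (I : Input X) (ζ s n : ℝ) (T : Tree H) (ℓ : Address)
    (y : Ω × ℝ) : Prop :=
  |y.2| ≤ s ∧ (n ≤ (T.dataAt I.S ℓ).card → Accurate (T.dataAt I.S ℓ) ζ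
    (PS y.1 (T.dataAt I.S ℓ) (I.α / 2 * I.B ℓ.length / 2) I.callDelta))

/-- The treatment of the child `i` in an iteration succeeds. -/
def StepGood (PS : Splitter H Ω) (I : Input X) (ζ s n : ℝ) (st : State H) (i : Bool)
    (y : Ω × ℝ) : Prop :=
  ∀ e, st.queue.argmax Item.priority = some e →
    CallGood PS I ζ s n (st.tree.split e.leaf e.h) (e.leaf ++ [i]) y

/-- All calls in the first `t` iterations succeed. -/
def RunGood (PS : Splitter H Ω) (I : Input X) (ζ s n : ℝ) (t : ℕ) (r : ℕ × Bool → Ω × ℝ) : Prop :=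
  Accurate I.S ζ (PS (r (0, false)).1 I.S (I.α / 2 * I.B 1) I.callDelta) ∧
    ∀ k < t, ∀ i, StepGood PS I ζ s n (stateAfter PS I r k) i (r (k + 1, i))

/-- Success probability of PrivateSplit with privacy parameter at least `α₀`. -/
theorem Splitter.IsUseful.ofReal_le [MeasurableSpace Ω] {P : Measure Ω} {PS : Splitter H Ω}
    {f : X → Bool} {N : ℝ → ℝ → ℝ → ℝ} {ζ : ℝ} (hU : PS.IsUseful P f N)
    (hN : ∀ ζ δ : ℝ, 0 < ζ → 0 < δ → δ ≤ 1 → AntitoneOn (fun α => N ζ α δ) (Set.Ioi 0))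
    (hζ : 0 < ζ) {α₀ α δ : ℝ} (hα₀ : 0 < α₀) (hα : α₀ ≤ α) (hδ : 0 < δ) (hδ1 : δ ≤ 1)
    {S : Dataset X} (hS : LabelledBy f S) (hcard : N ζ α₀ δ ≤ S.card) :
    ENNReal.ofReal (1 - δ) ≤ P {ω | Accurate S ζ (PS ω S α δ)} :=
  hU ζ α δ hζ (hα₀.trans_le hα) hδ hδ1 S hS
    ((hN ζ δ hζ hδ hδ1 hα₀ (hα₀.trans_le hα) hα).trans hcard)

section Probability

variable [MeasurableSpace Ω] {P : Measure Ω} [IsProbabilityMeasure P] {PS : Splitter H Ω}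
  {f : X → Bool} {N : ℝ → ℝ → ℝ → ℝ} {I : Input X} {b ζ s : ℝ}

/-- Noise and PrivateSplit use independent randomness, so the event is a rectangle. For light data
the accuracy requirement is void. -/
theorem ofReal_le_prod_callGood (hU : PS.IsUseful P f N)
    (hN : ∀ ζ δ : ℝ, 0 < ζ → 0 < δ → δ ≤ 1 → AntitoneOn (fun α => N ζ α δ) (Set.Ioi 0))
    (hζ : 0 < ζ) (hs : 0 ≤ s) (hα : 0 < I.α) (hb : 0 < b) (hB : ∀ d ∈ Set.Icc 1 I.M, b ≤ I.B d)
    (hδ : 0 < I.callDelta) (hδ1 : I.callDelta ≤ 1) (hS : LabelledBy f I.S) (T : Tree H)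
    (ℓ : Address) (hℓ : ℓ.length ∈ Set.Icc 1 I.M) :
    ENNReal.ofReal (1 - (I.callDelta + Real.exp (-s))) ≤
      P.prod laplace {y | CallGood PS I ζ s (N ζ (I.α * b / 4) I.callDelta) T ℓ y} := by
  set n := N ζ (I.α * b / 4) I.callDelta
  set D := T.dataAt I.S ℓ with hD
  have h1 : ENNReal.ofReal (1 - I.callDelta) ≤ P {ω | n ≤ D.card →
      Accurate D ζ (PS ω D (I.α / 2 * I.B ℓ.length / 2) I.callDelta)} := by
    by_cases hn : n ≤ D.card
    · simp only [hn, true_imp_iff]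
      have := hB _ hℓ
      -- A new leaf gets the privacy parameter α B(depth)/4 ≥ αb/4, and the data requirement is
      -- nonincreasing in it.
      exact hU.ofReal_le hN hζ (α₀ := I.α * b / 4) (by positivity)
        (by nlinarith) hδ hδ1 (hS.dataAt T ℓ) hn
    · simp only [hn, false_imp_iff]
      have : {ω : Ω | True} = Set.univ := by ext; simp
      rw [this, measure_univ]
      exact ENNReal.ofReal_le_one.2 (by linarith)
  have h2 := ofReal_one_sub_exp_le_laplace hs
  have hset : {y : Ω × ℝ | CallGood PS I ζ s n T ℓ y}
      = {ω | n ≤ D.card → Accurate D ζ (PS ω D (I.α / 2 * I.B ℓ.length / 2) I.callDelta)}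
        ×ˢ {z | |z| ≤ s} := by
    ext y
    simp only [CallGood, Set.mem_ofPred_eq, Set.mem_prod, and_comm, ← hD]
  rw [hset, Measure.prod_prod]
  exact (ofReal_one_sub_mul_ofReal_one_sub hδ.le (Real.exp_pos _).le).trans (mul_le_mul' h1 h2)

/-- The coordinates are revealed one by one. The data of each call are fixed by earlier coordinates,
so its own coordinate may be resampled. There is one noiseless call at the root and two calls per
iteration. -/
theorem ofReal_le_infinitePi_runGood (hU : PS.IsUseful P f N)
    (hN : ∀ ζ δ : ℝ, 0 < ζ → 0 < δ → δ ≤ 1 → AntitoneOn (fun α => N ζ α δ) (Set.Ioi 0))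
    (hζ : 0 < ζ) (hs : 0 ≤ s) (hα : 0 < I.α) (hb : 0 < b) (hB : ∀ d ∈ Set.Icc 1 I.M, b ≤ I.B d)
    (hδ : 0 < I.callDelta) (hδ1 : I.callDelta ≤ 1) (hS : LabelledBy f I.S)
    (hcard : N ζ (I.α * b / 4) I.callDelta ≤ I.S.card) (hM : 1 ≤ I.M) {t : ℕ} (ht : t ≤ I.M) :
    ENNReal.ofReal (1 - (I.callDelta + 2 * t * (I.callDelta + Real.exp (-s)))) ≤
      Measure.infinitePi (fun _ : ℕ × Bool => P.prod laplace)
        {r | RunGood PS I ζ s (N ζ (I.α * b / 4) I.callDelta) t r} := by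
  set n := N ζ (I.α * b / 4) I.callDelta with hn
  have hp : 0 ≤ I.callDelta + Real.exp (-s) := by positivity
  induction t with
  | zero =>
    have h1 : ENNReal.ofReal (1 - I.callDelta) ≤
        P {ω | Accurate I.S ζ (PS ω I.S (I.α / 2 * I.B 1) I.callDelta)} := by
      have := hB 1 ⟨le_rfl, hM⟩
      exact hU.ofReal_le hN hζ (α₀ := I.α * b / 4) (by positivity)
        (by nlinarith [mul_pos hα hb]) hδ hδ1 hS hcard
    have h2 := mul_le_infinitePi_of_forall_update (ι := ℕ × Bool) (P.prod laplace) (0, false)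
      Set.univ {r | RunGood PS I ζ s n 0 r} (ENNReal.ofReal (1 - I.callDelta)) fun r _ => by
        have hset : {y : Ω × ℝ | Function.update r (0, false) y ∈ {r | RunGood PS I ζ s n 0 r}}
            = {ω | Accurate I.S ζ (PS ω I.S (I.α / 2 * I.B 1) I.callDelta)} ×ˢ Set.univ := by
          ext y
          simp [RunGood]
        rw [hset, Measure.prod_prod, measure_univ, mul_one]
        exact h1
    rw [measure_univ, one_mul] at h2
    simpa using h2
  | succ t ih =>
    have ih := ih (by omega)
    have hcall : ∀ r i, ENNReal.ofReal (1 - (I.callDelta + Real.exp (-s))) ≤ P.prod laplace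
        {y | StepGood PS I ζ s n (stateAfter PS I r t) i y} := by
      intro r i
      rcases he : (stateAfter PS I r t).queue.argmax Item.priority with _ | e
      · have hset : {y : Ω × ℝ | StepGood PS I ζ s n (stateAfter PS I r t) i y} = Set.univ := by
          ext y
          simp [StepGood, he]
        rw [hset, measure_univ]
        exact ENNReal.ofReal_le_one.2 (by linarith)
      · have hset : {y : Ω × ℝ | StepGood PS I ζ s n (stateAfter PS I r t) i y}
            = {y | CallGood PS I ζ s n ((stateAfter PS I r t).tree.split e.leaf e.h)
                (e.leaf ++ [i]) y} := by
          ext y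
          simp [StepGood, he]
        rw [hset]
        have hw := wellFormed_stateAfter PS I r t
        -- Leaves have depth at most t, so the new ones lie within the range 1, ..., M where B ≥ b.
        have hd := hw.depth _ (hw.mem_leaves e (List.argmax_mem he))
        exact ofReal_le_prod_callGood hU hN hζ hs hα hb hB hδ hδ1 hS _ _
          ⟨by simp, by simp; omega⟩
    have hst : ∀ r i y, ∀ k ≤ t, stateAfter PS I (Function.update r (t + 1, i) y) k
        = stateAfter PS I r k := fun r i y k hk =>
      stateAfter_congr PS I fun j hj i' => by
        rw [Function.update_of_ne]
        simp only [ne_eq, Prod.mk.injEq, not_and]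
        omega
    have hrun : ∀ r i y, RunGood PS I ζ s n t r →
        RunGood PS I ζ s n t (Function.update r (t + 1, i) y) := by
      intro r i y hr
      refine ⟨by simpa using hr.1, fun k hk i' => ?_⟩
      rw [hst r i y k hk.le, Function.update_of_ne]
      · exact hr.2 k hk i'
      · simp only [ne_eq, Prod.mk.injEq, not_and]
        omega
    -- The two children are treated in turn; both calls see the same state, so resampling one leaves
    -- the other's success intact.
    have h1 := mul_le_infinitePi_of_forall_update (ι := ℕ × Bool) (P.prod laplace) (t + 1, false)
      {r | RunGood PS I ζ s n t r}
      {r | RunGood PS I ζ s n t r ∧ StepGood PS I ζ s n (stateAfter PS I r t) false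
        (r (t + 1, false))} _ fun r hr => (hcall r false).trans (measure_mono fun y hy => by
          refine ⟨hrun r false y hr, ?_⟩
          rw [hst r false y t le_rfl, Function.update_self]
          exact hy)
    have h2 := mul_le_infinitePi_of_forall_update (ι := ℕ × Bool) (P.prod laplace) (t + 1, true)
      {r | RunGood PS I ζ s n t r ∧ StepGood PS I ζ s n (stateAfter PS I r t) false
        (r (t + 1, false))}
      {r | RunGood PS I ζ s n (t + 1) r} _ fun r hr =>
        (hcall r true).trans (measure_mono fun y hy => by
          have hr' := hrun r true y hr.1
          refine ⟨hr'.1, fun k hk i => ?_⟩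
          rcases Nat.lt_succ_iff_lt_or_eq.1 hk with hk | rfl
          · exact hr'.2 k hk i
          · rw [hst r true y k le_rfl]
            cases i
            · rw [Function.update_of_ne (by simp)]
              exact hr.2
            · rw [Function.update_self]
              exact hy)
    refine le_trans ?_ h2
    refine le_trans ?_ (mul_le_mul_left h1 _)
    refine le_trans ?_ (mul_le_mul_left (mul_le_mul_left ih _) _)
    refine le_trans ?_ (mul_le_mul_left (ofReal_one_sub_mul_ofReal_one_sub (by positivity) hp) _)
    refine le_trans (le_of_eq ?_) (ofReal_one_sub_mul_ofReal_one_sub (by positivity) hp)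
    congr 1
    push_cast
    ring

end Probability

/-- The item `e` carries an almost optimal splitting function for the data `D` at its leaf, and its
priority is almost its contribution to the decrease of the potential. -/
def ItemGood (m : ℕ) (ζ : ℝ) (D : Dataset X) (e : Item H) : Prop :=
  (∀ h ∈ H, J D h - ζ ≤ J D e.h.1) ∧ |e.priority - D.card / m * J D e.h.1| ≤ 3 * ζ

/-- Passing the noisy threshold ε/M with noise at most ε/(2M) means a true weight of at least
ε/(2M), which is enough data for accuracy. Failing it bounds the true weight by ε/M + ζ. -/
theorem processLeaf_good {PS : Splitter H Ω} {I : Input X} {ζ s n : ℝ} {T : Tree H} {ℓ : Address}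
    {y : Ω × ℝ} (hgood : CallGood PS I ζ s n T ℓ y) (hS : (0 : ℝ) < I.S.card)
    (hα : 0 < I.α) (hB : 0 < I.B ℓ.length)
    (hnoise : 2 / (I.S.card * (I.α / 2 * I.B ℓ.length)) * s ≤ ζ) (hζ : ζ ≤ I.ε / I.M / 2)
    (hζ1 : ζ ≤ 1) (hn : n ≤ I.ε / I.M / 2 * I.S.card) :
    (∀ e ∈ processLeaf PS I T ℓ y.1 y.2, ItemGood I.S.card ζ (T.dataAt I.S ℓ) e) ∧
    (processLeaf PS I T ℓ y.1 y.2 = [] →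
      ((T.dataAt I.S ℓ).card : ℝ) / I.S.card ≤ I.ε / I.M + ζ) := by
  set D := T.dataAt I.S ℓ with hD
  obtain ⟨hz, hacc⟩ := hgood
  rw [← hD] at hacc
  have hc : 0 ≤ 2 / (I.S.card * (I.α / 2 * I.B ℓ.length)) := by positivity
  set c := 2 / (I.S.card * (I.α / 2 * I.B ℓ.length)) with hcdef
  have hzc : |c * y.2| ≤ ζ := by
    rw [abs_mul, abs_of_nonneg hc]
    exact (mul_le_mul_of_nonneg_left hz hc).trans hnoise
  have hz' := abs_le.1 hzc
  have hζ0 : 0 ≤ ζ := (abs_nonneg _).trans hzc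
  unfold processLeaf
  simp only [← hD, ← hcdef]
  split_ifs with hw
  · refine ⟨fun e he => ?_, fun h => by simp at h⟩
    rw [List.mem_singleton] at he
    subst he
    have hcard : n ≤ D.card := by
      refine hn.trans ?_
      rw [← le_div_iff₀ hS]
      linarith [hz'.2]
    obtain ⟨h1, h2⟩ := hacc hcard
    refine ⟨h1, ?_⟩
    simp only
    have hJ := abs_J_le_one D (PS y.1 D (I.α / 2 * I.B ℓ.length / 2) I.callDelta).1.1
    set out := PS y.1 D (I.α / 2 * I.B ℓ.length / 2) I.callDelta
    have hw1 : (D.card : ℝ) / I.S.card ≤ 1 := by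
      refine div_le_one_of_le₀ ?_ hS.le
      exact_mod_cast Multiset.card_le_card (Multiset.filter_le _ _)
    have hw0 : (0 : ℝ) ≤ D.card / I.S.card := by positivity
    have hout : |out.2| ≤ 2 := by
      have : out.2 = J D out.1.1 - (J D out.1.1 - out.2) := by ring
      rw [this]
      exact (abs_sub _ _).trans (by linarith)
    -- The error 3ζ consists of 2ζ from the noise in the weight, times |Ĵ| ≤ 2, and ζ from the error
    -- of Ĵ, times a weight at most 1.
    have hdec : ((D.card : ℝ) / I.S.card + c * y.2) * out.2 - D.card / I.S.card * J D out.1.1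
        = c * y.2 * out.2 - D.card / I.S.card * (J D out.1.1 - out.2) := by ring
    rw [hdec]
    refine (abs_sub _ _).trans ?_
    rw [abs_mul (c * y.2) out.2, abs_mul ((D.card : ℝ) / I.S.card) (J D out.1.1 - out.2),
      abs_of_nonneg hw0]
    have e1 := mul_le_mul hzc hout (abs_nonneg _) hζ0
    have e2 := mul_le_mul hw1 h2 (abs_nonneg _) zero_le_one
    linarith
  · refine ⟨fun e he => by simp at he, fun _ => ?_⟩
    linarith [hz'.1]

/-- Properties of the state when all calls succeed. -/
structure QueueGood (I : Input X) (ζ : ℝ) (st : State H) : Prop where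
  item : ∀ e ∈ st.queue, ItemGood I.S.card ζ (st.tree.dataAt I.S e.leaf) e
  light : ∀ ℓ ∈ st.tree.leaves, (∀ e ∈ st.queue, e.leaf ≠ ℓ) →
    ((st.tree.dataAt I.S ℓ).card : ℝ) / I.S.card ≤ I.ε / I.M + ζ

theorem queueGood_init {PS : Splitter H Ω} {I : Input X} {ζ : ℝ} {ω : Ω}
    (hacc : Accurate I.S ζ (PS ω I.S (I.α / 2 * I.B 1) I.callDelta)) (hS : (0 : ℝ) < I.S.card) :
    QueueGood I ζ (init PS I ω) := by
  have hζ0 : 0 ≤ ζ := (abs_nonneg _).trans hacc.2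
  constructor
  · intro e he
    simp only [init, List.mem_singleton] at he
    subst he
    have hD : (init PS I ω).tree.dataAt I.S [] = I.S := by simp [init, Tree.dataAt, Tree.route]
    simp only [hD]
    refine ⟨hacc.1, ?_⟩
    simp only
    rw [div_self hS.ne', one_mul, abs_sub_comm]
    exact hacc.2.trans (by linarith)
  · intro ℓ hℓ hne
    have : ℓ = [] := by simpa [init, Tree.leaves] using hℓ
    exact absurd this.symm (hne ⟨[], _, _⟩ (by simp [init]; exact ⟨rfl, rfl⟩))

theorem QueueGood.step {PS : Splitter H Ω} {I : Input X} {ζ s n : ℝ} {k : ℕ} {st : State H}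
    (hq : QueueGood I ζ st) (hw : WellFormed k st) (hk : k < I.M) {y : Bool → Ω × ℝ}
    (hgood : ∀ i, StepGood PS I ζ s n st i (y i)) (hS : (0 : ℝ) < I.S.card)
    (hα : 0 < I.α) (hB : ∀ d ∈ Set.Icc 1 I.M, 0 < I.B d)
    (hnoise : ∀ d ∈ Set.Icc 1 I.M, 2 / (I.S.card * (I.α / 2 * I.B d)) * s ≤ ζ)
    (hζ : ζ ≤ I.ε / I.M / 2) (hζ1 : ζ ≤ 1) (hn : n ≤ I.ε / I.M / 2 * I.S.card) :
    QueueGood I ζ (step PS I st y) := by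
  rcases he : st.queue.argmax Item.priority with _ | e
  · rwa [step_of_argmax_eq_none PS I y he]
  have heq : e ∈ st.queue := List.argmax_mem he
  have hℓ := hw.mem_leaves e heq
  have htree : (DPTree.step PS I st y).tree = st.tree.split e.leaf e.h := by
    rw [step_of_argmax_eq_some PS I y he]
  have hlen : ∀ i, (e.leaf ++ [i]).length ∈ Set.Icc 1 I.M := fun i => by
    have := hw.depth _ hℓ
    exact ⟨by simp, by simp; omega⟩
  have hproc := fun i => processLeaf_good (hgood i e he) hS hα (hB _ (hlen i))
    (hnoise _ (hlen i)) hζ hζ1 hn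
  constructor
  · intro e' he'
    rw [htree]
    rcases (mem_queue_step he).1 he' with ⟨h1, h2⟩ | ⟨i, hi⟩
    · rw [Tree.dataAt_split_of_ne hℓ (hw.mem_leaves e' h1) h2]
      exact hq.item e' h1
    · rw [leaf_eq_of_mem_processLeaf hi]
      exact (hproc i).1 e' hi
  · intro p hp hne
    rw [htree] at hp ⊢
    rcases Tree.mem_leaves_split hℓ _ hp with ⟨h1, h2⟩ | ⟨i, rfl⟩
    · rw [Tree.dataAt_split_of_ne hℓ h1 h2]
      refine hq.light p h1 fun e' he' hpe => ?_
      exact hne e' ((mem_queue_step he).2 (Or.inl ⟨he', hpe ▸ h2⟩)) hpe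
    · refine (hproc i).2 (List.eq_nil_iff_forall_not_mem.2 fun e' he' => ?_)
      exact hne e' ((mem_queue_step he).2 (Or.inr ⟨i, he'⟩)) (leaf_eq_of_mem_processLeaf he')

theorem RunGood.queueGood {PS : Splitter H Ω} {I : Input X} {ζ s n : ℝ} {t : ℕ}
    {r : ℕ × Bool → Ω × ℝ} (hr : RunGood PS I ζ s n t r) (ht : t ≤ I.M) (hS : (0 : ℝ) < I.S.card)
    (hα : 0 < I.α) (hB : ∀ d ∈ Set.Icc 1 I.M, 0 < I.B d)
    (hnoise : ∀ d ∈ Set.Icc 1 I.M, 2 / (I.S.card * (I.α / 2 * I.B d)) * s ≤ ζ)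
    (hζ : ζ ≤ I.ε / I.M / 2) (hζ1 : ζ ≤ 1) (hn : n ≤ I.ε / I.M / 2 * I.S.card) {k : ℕ}
    (hk : k ≤ t) : QueueGood I ζ (stateAfter PS I r k) := by
  induction k with
  | zero => exact queueGood_init hr.1 hS
  | succ k ih =>
    exact (ih (by omega)).step (wellFormed_stateAfter PS I r k) (by omega)
      (fun i => hr.2 k (by omega) i) hS hα hB hnoise hζ hζ1 hn

end Good

/-! ### Decay of the entropy potential -/

section Convergence

variable {X : Type*} {H : Set (X → Bool)} {Ω : Type*}

theorem exists_div_le_of_le_sum_map {α : Type*} (l : List α) (g : α → ℝ) {m V : ℝ} (hV : 0 < V)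
    (hl : l.length ≤ m) (hsum : V ≤ (l.map g).sum) : ∃ a ∈ l, V / m ≤ g a := by
  by_contra! hcon
  have hne : l ≠ [] := by
    rintro rfl
    simp at hsum
    linarith
  have hlpos : (0 : ℝ) < l.length := by exact_mod_cast List.length_pos_iff.2 hne
  have hm : 0 < m := hlpos.trans_le hl
  have h1 : (l.map g).sum < (l.map fun _ => V / m).sum :=
    List.sum_lt_sum_of_ne_nil hne _ _ hcon
  rw [List.map_const', List.sum_replicate, nsmul_eq_mul] at h1
  have h2 : l.length * (V / m) ≤ m * (V / m) := mul_le_mul_of_nonneg_right hl (by positivity)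
  rw [mul_div_cancel₀ _ hm.ne'] at h2
  linarith

/-- The item of highest priority decreases the entropy by almost the amount that weak learning
guarantees for the average item. -/
theorem QueueGood.le_card_mul_J {I : Input X} {ζ : ℝ} {k : ℕ} {st : State H} {f : X → Bool} {γ : ℝ}
    (hq : QueueGood I ζ st) (hw : WellFormed k st) (hW : WeakLearning H f γ) (hγ : 0 ≤ γ)
    (hlab : LabelledBy f I.S) (hS : (0 : ℝ) < I.S.card) (hζ : 0 ≤ ζ)
    (hE : 0 < queueSum err I.S st) {e : Item H} (he : st.queue.argmax Item.priority = some e) :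
    4 * γ ^ 2 * (queueSum err I.S st / (k + 1)) - 7 * ζ * I.S.card ≤
      (st.tree.dataAt I.S e.leaf).card * J (st.tree.dataAt I.S e.leaf) e.h.1 := by
  obtain ⟨e', he', hlarge⟩ := exists_div_le_of_le_sum_map st.queue
    (fun e => err (st.tree.dataAt I.S e.leaf)) (m := k + 1) hE
    (by exact_mod_cast hw.length_queue) le_rfl
  change queueSum err I.S st / (k + 1) ≤ _ at hlarge
  have herr : 0 < err (st.tree.dataAt I.S e'.leaf) :=
    lt_of_lt_of_le (by positivity) hlarge
  obtain ⟨h, hH, hJ⟩ := hW.exists_card_mul_J hγ (hlab.dataAt st.tree e'.leaf) herr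
  obtain ⟨h1, h2⟩ := hq.item e' he'
  obtain ⟨-, h3⟩ := hq.item e (List.argmax_mem he)
  have hprio := List.le_of_mem_argmax he' he
  have h1 := h1 h hH
  have h2 := (abs_le.1 h2).1
  have h3 := (abs_le.1 h3).2
  set D := st.tree.dataAt I.S e.leaf
  set D' := st.tree.dataAt I.S e'.leaf
  have hw0 : (0 : ℝ) ≤ D'.card / I.S.card := by positivity
  have hw1 : (D'.card : ℝ) / I.S.card ≤ 1 := by
    refine div_le_one_of_le₀ ?_ hS.le
    exact_mod_cast Multiset.card_le_card (Multiset.filter_le _ _)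
  have h4 := mul_le_mul_of_nonneg_left h1 hw0
  have h5 := mul_le_mul_of_nonneg_right hw1 hζ
  have h6 : 4 * γ ^ 2 * (queueSum err I.S st / (k + 1)) ≤ D'.card * J D' h :=
    (mul_le_mul_of_nonneg_left hlarge (by positivity)).trans hJ
  -- 3ζ is lost in each of the two priorities and ζ in the near-optimality of the splitting function
  -- stored with the average item.
  have h7 : D'.card / I.S.card * J D' h - 7 * ζ ≤ D.card / I.S.card * J D e.h.1 := by
    rw [mul_sub] at h4
    linarith
  have h8 := mul_le_mul_of_nonneg_right h7 hS.le
  have e1 : (D'.card / I.S.card * J D' h - 7 * ζ) * I.S.card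
      = D'.card * J D' h - 7 * ζ * I.S.card := by field_simp
  have e2 : D.card / I.S.card * J D e.h.1 * I.S.card = D.card * J D e.h.1 := by field_simp
  rw [e1, e2] at h8
  linarith

/-- As long as the error in the queue is large, it is comparable with the entropy in the queue. -/
theorem queueSum_ent_le_of_large (PS : Splitter H Ω) (I : Input X) (r : ℕ × Bool → Ω × ℝ) (k : ℕ)
    (hε : 0 < I.ε) (hε1 : I.ε ≤ 1)
    (hE : 2 / 5 * I.ε * I.S.card ≤ queueSum err I.S (stateAfter PS I r k)) :
    queueSum ent I.S (stateAfter PS I r k)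
      ≤ 7 * Real.log (2 / I.ε) * queueSum err I.S (stateAfter PS I r k) := by
  -- With this θ the additive term is at most θ|S| ≤ E and is absorbed into E.
  have h1 := queueSum_ent_mul_log_two_le I.S (stateAfter PS I r k)
    (θ := 2 / 5 * I.ε) (by positivity)
  have h2 := mul_le_mul_of_nonneg_left (queueSum_card_le PS I I.S r k)
    (show 0 ≤ 2 / 5 * I.ε by positivity)
  set E := queueSum err I.S (stateAfter PS I r k)
  set Φ := queueSum ent I.S (stateAfter PS I r k)
  have hE0 : 0 ≤ E := le_trans (by positivity) hE
  have hlog : Real.log (1 / (2 / 5 * I.ε)) ≤ 1 / 4 + Real.log (2 / I.ε) := by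
    have : 1 / (2 / 5 * I.ε) = 5 / 4 * (2 / I.ε) := by field_simp; norm_num
    rw [this, Real.log_mul (by norm_num) (by positivity)]
    have := Real.log_le_sub_one_of_pos (show (0 : ℝ) < 5 / 4 by norm_num)
    linarith
  have hL : Real.log 2 ≤ Real.log (2 / I.ε) :=
    Real.log_le_log (by norm_num) (by rw [le_div_iff₀ hε]; linarith)
  have hl2 := Real.log_two_gt_d9
  set L := Real.log (2 / I.ε)
  have h3 : Φ * Real.log 2 ≤ E * (13 / 3 * L) := by
    have : E * (Real.log (1 / (2 / 5 * I.ε)) + 1) ≤ E * (L + 5 / 4) :=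
      mul_le_mul_of_nonneg_left (by linarith) hE0
    have : E * (L + 9 / 4) ≤ E * (13 / 3 * L) := mul_le_mul_of_nonneg_left (by linarith) hE0
    linarith
  have hEL : 0 ≤ E * L := mul_nonneg hE0 (by linarith)
  nlinarith

/-- After many successful iterations, the error at the leaves in the queue is small. -/
theorem RunGood.queueSum_err_le {PS : Splitter H Ω} {I : Input X} {ζ s n : ℝ} {t : ℕ}
    {r : ℕ × Bool → Ω × ℝ} {f : X → Bool} {γ : ℝ} (hr : RunGood PS I ζ s n t r) (ht : t ≤ I.M)
    (ht0 : 0 < t) (hW : WeakLearning H f γ) (hγ : 0 ≤ γ) (hlab : LabelledBy f I.S)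
    (hS : (0 : ℝ) < I.S.card) (hα : 0 < I.α) (hε : 0 < I.ε) (hε1 : I.ε ≤ 1)
    (hB : ∀ d ∈ Set.Icc 1 I.M, 0 < I.B d)
    (hnoise : ∀ d ∈ Set.Icc 1 I.M, 2 / (I.S.card * (I.α / 2 * I.B d)) * s ≤ ζ)
    (hζ0 : 0 ≤ ζ) (hζ : ζ ≤ I.ε / I.M / 2) (hζ1 : ζ ≤ 1) (hn : n ≤ I.ε / I.M / 2 * I.S.card)
    (hζγ : 7 * ζ ≤ 4 / 5 * (γ ^ 2 * I.ε / I.M))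
    (hlarge : Real.log (5 / (2 * I.ε)) ≤ 2 / 7 * γ ^ 2 / Real.log (2 / I.ε) * Real.log t) :
    queueSum err I.S (stateAfter PS I r t) ≤ 2 / 5 * I.ε * I.S.card := by
  -- By monotonicity, an error above the threshold at time t stays above it at all k ≤ t, so the
  -- potential decays all along.
  by_contra! hcon
  have hM : (0 : ℝ) < I.M := by exact_mod_cast (by omega : 0 < I.M)
  have hanti := queueSum_stateAfter_antitone PS I err_nonneg err_child_add_le I.S r
  have hL : 0 < Real.log (2 / I.ε) := Real.log_pos (by rw [lt_div_iff₀ hε]; linarith)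
  set L := Real.log (2 / I.ε) with hLdef
  set a := 2 / 7 * γ ^ 2 / L with ha
  have ha0 : 0 ≤ a := by positivity
  have hpot : ∀ k ≤ t, queueSum ent I.S (stateAfter PS I r k)
      ≤ I.S.card * Real.exp (-(a * Real.log (k + 1))) := by
    intro k hk
    induction k with
    | zero =>
      have : queueSum ent I.S (stateAfter PS I r 0) = ent I.S := queueSum_init PS I ent I.S _
      rw [this]
      simpa using ent_le_card I.S
    | succ k ih =>
      have ih := ih (by omega)
      have hEk : 2 / 5 * I.ε * I.S.card < queueSum err I.S (stateAfter PS I r k) :=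
        hcon.trans_le (hanti (by omega : k ≤ t))
      have hEpos : 0 < queueSum err I.S (stateAfter PS I r k) := lt_of_le_of_lt (by positivity) hEk
      have hw := wellFormed_stateAfter PS I r k
      have hq := hr.queueGood ht hS hα hB hnoise hζ hζ1 hn (by omega : k ≤ t)
      have hent := queueSum_ent_le_of_large PS I r k hε hε1 hEk.le
      have hstep : stateAfter PS I r (k + 1)
        = step PS I (stateAfter PS I r k) fun i => r (k + 1, i) := rfl
      rw [hstep]
      set st := stateAfter PS I r k
      rcases he : st.queue.argmax Item.priority with _ | e
      · rw [List.argmax_eq_none] at he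
        simp [queueSum, he] at hEpos
      have hdrop := hq.le_card_mul_J hw hW hγ hlab hS hζ0 hEpos he
      have hsum := queueSum_step_le PS I ent_nonneg hw I.S (fun i => r (k + 1, i)) he
      rw [card_mul_J] at hdrop
      set E := queueSum err I.S st
      set Φ := queueSum ent I.S st
      have hk1 : (0 : ℝ) < k + 1 := by positivity
      have hkM : (k : ℝ) + 1 ≤ I.M := by exact_mod_cast (by omega : k + 1 ≤ I.M)
      -- Half of the gain 4γ²E/(k+1) pays for the inaccuracy; here k + 1 ≤ M and the lower bound on
      -- E enter.
      have hslack : 7 * ζ * I.S.card ≤ 2 * γ ^ 2 * (E / (k + 1)) := by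
        have h1 : 2 / 5 * I.ε * I.S.card / I.M ≤ E / (k + 1) :=
          div_le_div₀ hEpos.le hEk.le hk1 hkM
        have h2 := mul_le_mul_of_nonneg_left h1 (show 0 ≤ 2 * γ ^ 2 by positivity)
        have h3 := mul_le_mul_of_nonneg_right hζγ hS.le
        have h4 : 4 / 5 * (γ ^ 2 * I.ε / I.M) * I.S.card
            = 2 * γ ^ 2 * (2 / 5 * I.ε * I.S.card / I.M) := by ring
        linarith
      have hrate : a / (k + 1) * Φ ≤ 2 * γ ^ 2 * (E / (k + 1)) := by
        have h1 := mul_le_mul_of_nonneg_left hent (show 0 ≤ a / (k + 1) by positivity)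
        have h2 : a / (k + 1) * (7 * L * E) = 2 * γ ^ 2 * (E / (k + 1)) := by
          rw [ha]; field_simp
        linarith
      have hΦ0 : 0 ≤ Φ := by
        refine hEpos.le.trans (queueSum_mono err_le_ent I.S st)
      -- From 1 - u ≤ exp(-u) and log((k+2)/(k+1)) ≤ 1/(k+1); the product of these factors
      -- telescopes to (k+1)^(-a).
      have hexp : (1 - a / (k + 1)) * Φ
          ≤ Real.exp (-(a * (Real.log (k + 1 + 1) - Real.log (k + 1)))) * Φ := by
        refine mul_le_mul_of_nonneg_right ?_ hΦ0
        have h1 := Real.add_one_le_exp (-(a / (k + 1)))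
        have h2 : Real.log (k + 1 + 1) - Real.log (k + 1) ≤ 1 / (k + 1) := by
          rw [← Real.log_div (by positivity) hk1.ne']
          refine (Real.log_le_sub_one_of_pos (by positivity)).trans (le_of_eq ?_)
          field_simp; ring
        have h3 : Real.exp (-(a / (k + 1)))
            ≤ Real.exp (-(a * (Real.log (k + 1 + 1) - Real.log (k + 1)))) := by
          refine Real.exp_le_exp.2 (neg_le_neg ?_)
          have := mul_le_mul_of_nonneg_left h2 ha0
          rwa [mul_one_div] at this
        linarith
      have hind := mul_le_mul_of_nonneg_left ih
        (Real.exp_pos (-(a * (Real.log (k + 1 + 1) - Real.log (k + 1))))).le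
      have hcomb : Real.exp (-(a * (Real.log (k + 1 + 1) - Real.log (k + 1))))
          * (I.S.card * Real.exp (-(a * Real.log (k + 1))))
          = I.S.card * Real.exp (-(a * Real.log (k + 1 + 1))) := by
        rw [mul_left_comm, ← Real.exp_add]
        ring_nf
      rw [hcomb] at hind
      push_cast
      linarith
  have hfin := hpot t le_rfl
  have hle := queueSum_mono err_le_ent I.S (stateAfter PS I r t)
  have ht1 : (0 : ℝ) < t := by exact_mod_cast ht0
  have hexp : Real.exp (-(a * Real.log (t + 1))) ≤ 2 / 5 * I.ε := by
    have h1 : Real.log t ≤ Real.log (t + 1) := Real.log_le_log ht1 (by linarith)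
    have h2 := mul_le_mul_of_nonneg_left h1 ha0
    have h3 : Real.exp (-Real.log (5 / (2 * I.ε))) = 2 / 5 * I.ε := by
      rw [Real.exp_neg, Real.exp_log (by positivity)]
      field_simp
    rw [← h3]
    exact Real.exp_le_exp.2 (by linarith)
  have := mul_le_mul_of_nonneg_left hexp hS.le
  linarith

end Convergence

/-! ### Errors of the noisy labelling -/

section Labelling

variable {X : Type*} {H : Set (X → Bool)} {Ω : Type*}

/-- The rejected label has the smaller noisy count, so its true count exceeds the other one by at
most two noises of size 4s/α. -/
theorem labelCount_not_noisyLabel_le (I : Input X) (T : Tree H) (z : Address × Bool → ℝ)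
    (ℓ : Address) {s : ℝ} (hα : 0 < I.α) (hz : ∀ y, |z (ℓ, y)| ≤ s) :
    (labelCount (T.dataAt I.S ℓ) (!noisyLabel I T z ℓ) : ℝ)
      ≤ err (T.dataAt I.S ℓ) + 8 / I.α * s := by
  have hc : 2 / (I.α / 2) = 4 / I.α := by field_simp; norm_num
  have hc0 : 0 ≤ 4 / I.α := by positivity
  have h8 : 8 / I.α * s = 2 * (4 / I.α * s) := by ring
  have hnoise : ∀ y, -(4 / I.α * s) ≤ 4 / I.α * z (ℓ, y) ∧ 4 / I.α * z (ℓ, y) ≤ 4 / I.α * s := by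
    intro y
    rw [← abs_le, abs_mul, abs_of_nonneg hc0]
    exact mul_le_mul_of_nonneg_left (hz y) hc0
  have hf := hnoise false
  have ht := hnoise true
  have hs : 0 ≤ 4 / I.α * s := mul_nonneg hc0 ((abs_nonneg _).trans (hz false))
  rw [← sub_le_iff_le_add, err, le_min_iff]
  unfold noisyLabel
  rw [hc, h8]
  by_cases hlt : (labelCount (T.dataAt I.S ℓ) false : ℝ) + 4 / I.α * z (ℓ, false)
    < (labelCount (T.dataAt I.S ℓ) true : ℝ) + 4 / I.α * z (ℓ, true)
  · simp only [hlt, decide_true, Bool.not_true]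
    constructor <;> linarith [hf.1, hf.2, ht.1, ht.2]
  · simp only [hlt, decide_false, Bool.not_false]
    constructor <;> linarith [hf.1, hf.2, ht.1, ht.2, not_lt.1 hlt]

/-- The number of errors of the noisy labelling, compared with the optimal labelling. -/
theorem card_filter_noisyLabel_le (I : Input X) (T : Tree H) (z : Address × Bool → ℝ) {s : ℝ}
    (hα : 0 < I.α) (hz : ∀ ℓ ∈ T.leaves, ∀ y, |z (ℓ, y)| ≤ s) :
    ((I.S.filter fun p => noisyLabel I T z (T.route p.1) ≠ p.2).card : ℝ)
      ≤ ∑ ℓ ∈ T.leaves, err (T.dataAt I.S ℓ) + T.leaves.card * (8 / I.α * s) := by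
  rw [card_filter_eq_sum_leaves T I.S]
  push_cast
  rw [← nsmul_eq_mul, ← Finset.sum_const, ← Finset.sum_add_distrib]
  refine Finset.sum_le_sum fun ℓ hℓ => ?_
  refine le_trans (le_of_eq ?_) (labelCount_not_noisyLabel_le I T z ℓ hα (hz ℓ hℓ))
  congr 2
  refine Multiset.filter_congr fun p hp => ?_
  have hroute : T.route p.1 = ℓ := (Multiset.mem_filter.1 hp).2
  rw [hroute]
  cases noisyLabel I T z ℓ <;> cases p.2 <;> simp

/-- Serves large ε, where the lower bound on t carries too little information. -/
theorem sum_err_leaves_le_half (T : Tree H) (S : Dataset X) :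
    ∑ ℓ ∈ T.leaves, err (T.dataAt S ℓ) ≤ S.card / 2 := by
  have h1 := card_filter_eq_sum_leaves T S fun _ => True
  simp only [Multiset.filter_true] at h1
  rw [h1]
  push_cast
  rw [Finset.sum_div]
  exact Finset.sum_le_sum fun ℓ _ => by linarith [two_mul_err_le_card (T.dataAt S ℓ)]

theorem sum_le_sum_map_of_forall_exists {α β : Type*} [DecidableEq β] (l : List α) (k : α → β)
    (g : β → ℝ) (hg : ∀ b, 0 ≤ g b) (s : Finset β) (hs : ∀ b ∈ s, ∃ a ∈ l, k a = b) :
    ∑ b ∈ s, g b ≤ (l.map fun a => g (k a)).sum := by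
  induction l generalizing s with
  | nil =>
    have : s = ∅ := Finset.eq_empty_of_forall_notMem fun b hb => by
      obtain ⟨a, ha, -⟩ := hs b hb
      simp at ha
    simp [this]
  | cons a l ih =>
    have h1 := ih (s.erase (k a)) fun b hb => by
      obtain ⟨hne, hb⟩ := Finset.mem_erase.1 hb
      obtain ⟨a', ha', rfl⟩ := hs b hb
      rcases List.mem_cons.1 ha' with rfl | h
      · exact absurd rfl hne
      · exact ⟨a', h, rfl⟩
    have h2 : ∑ b ∈ s, g b ≤ g (k a) + ∑ b ∈ s.erase (k a), g b := by
      by_cases h : k a ∈ s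
      · rw [Finset.add_sum_erase s g h]
      · rw [Finset.erase_eq_of_notMem h]
        linarith [hg (k a)]
    simp only [List.map_cons, List.sum_cons]
    linarith

/-- Leaves outside of the queue are light, so they contribute little to the error. -/
theorem QueueGood.sum_err_leaves_le {I : Input X} {ζ : ℝ} {k : ℕ} {st : State H}
    (hq : QueueGood I ζ st) (hw : WellFormed k st) (hS : (0 : ℝ) < I.S.card)
    (hεζ : 0 ≤ I.ε / I.M + ζ) :
    ∑ ℓ ∈ st.tree.leaves, err (st.tree.dataAt I.S ℓ) ≤ queueSum err I.S st
      + (k + 1) * ((I.ε / I.M + ζ) * I.S.card / 2) := by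
  classical
  rw [← Finset.sum_filter_add_sum_filter_not _ fun ℓ => ∃ e ∈ st.queue, e.leaf = ℓ]
  refine add_le_add ?_ ?_
  · exact sum_le_sum_map_of_forall_exists st.queue Item.leaf
      (fun ℓ => err (st.tree.dataAt I.S ℓ)) (fun _ => err_nonneg _) _
      fun ℓ hℓ => (Finset.mem_filter.1 hℓ).2
  · refine (Finset.sum_le_card_nsmul _ _ ((I.ε / I.M + ζ) * I.S.card / 2) fun ℓ hℓ => ?_).trans ?_
    · obtain ⟨h1, h2⟩ := Finset.mem_filter.1 hℓ
      have := hq.light ℓ h1 fun e he hel => h2 ⟨e, he, hel⟩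
      rw [div_le_iff₀ hS] at this
      linarith [two_mul_err_le_card (st.tree.dataAt I.S ℓ)]
    · rw [nsmul_eq_mul]
      refine mul_le_mul_of_nonneg_right ?_ (by positivity)
      have h1 := (Finset.card_filter_le st.tree.leaves
        fun ℓ => ¬∃ e ∈ st.queue, e.leaf = ℓ).trans hw.card_leaves
      exact_mod_cast h1

end Labelling

/-! ### Assembly of the estimates -/

section Main

variable {X : Type*} {H : Set (X → Bool)} {Ω : Type*}

/-- The training error after `t` successful iterations and a labelling with small noise. -/
theorem RunGood.trainError_le {PS : Splitter H Ω} {I : Input X} {ζ s n : ℝ} {t : ℕ}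
    {r : ℕ × Bool → Ω × ℝ} {z : Address × Bool → ℝ} {f : X → Bool} {γ : ℝ}
    (hr : RunGood PS I ζ s n t r)
    (hz : ∀ ℓ ∈ (stateAfter PS I r t).tree.leaves, ∀ y, |z (ℓ, y)| ≤ s)
    (hW : WeakLearning H f γ) (hγ : 0 < γ) (hγ1 : γ ≤ 1 / 2) (hlab : LabelledBy f I.S)
    (hS : (0 : ℝ) < I.S.card) (hα : 0 < I.α) (hε : 0 < I.ε) (hε1 : I.ε ≤ 1) (hM : 1 ≤ I.M)
    (hB : ∀ d ∈ Set.Icc 1 I.M, 0 < I.B d)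
    (hnoise : ∀ d ∈ Set.Icc 1 I.M, 2 / (I.S.card * (I.α / 2 * I.B d)) * s ≤ ζ)
    (hζ0 : 0 ≤ ζ) (hζ : ζ ≤ γ ^ 2 * I.ε / I.M / 13) (hn : n ≤ I.ε / I.M / 2 * I.S.card)
    (hs : 0 ≤ s) (hlabel : I.M * (16 / I.α * s) ≤ I.ε / 40 * I.S.card)
    (ht : (1 / I.ε) ^ (100 * Real.log (1 / I.ε) / γ ^ 2) ≤ (t : ℝ)) (htM : t ≤ I.M) :
    trainError I.S (classifierAfter PS I t (r, z)) ≤ I.ε := by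
  have hM1 : (1 : ℝ) ≤ I.M := by exact_mod_cast hM
  have htM' : (t : ℝ) ≤ I.M := by exact_mod_cast htM
  have hγ2 : γ ^ 2 ≤ 1 / 4 := by nlinarith
  have hεM : 0 < I.ε / I.M := by positivity
  have hκ : γ ^ 2 * I.ε / I.M ≤ 1 / 4 * (I.ε / I.M) := by
    rw [mul_div_assoc]
    exact mul_le_mul_of_nonneg_right hγ2 hεM.le
  have hκ0 : 0 ≤ γ ^ 2 * I.ε / I.M := by positivity
  have hεM1 : I.ε / I.M ≤ 1 := div_le_one_of_le₀ (by linarith) (by linarith)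
  have hw := wellFormed_stateAfter PS I r t
  have hcount := card_filter_noisyLabel_le I (stateAfter PS I r t).tree z hα hz
  have hleaves : ((stateAfter PS I r t).tree.leaves.card : ℝ) * (8 / I.α * s)
      ≤ I.ε / 40 * I.S.card := by
    have h1 : ((stateAfter PS I r t).tree.leaves.card : ℝ) ≤ 2 * I.M := by
      have : ((stateAfter PS I r t).tree.leaves.card : ℝ) ≤ t + 1 := by
        exact_mod_cast hw.card_leaves
      linarith
    have h2 := mul_le_mul_of_nonneg_right h1 (show 0 ≤ 8 / I.α * s by positivity)
    have h3 : 2 * (I.M : ℝ) * (8 / I.α * s) = I.M * (16 / I.α * s) := by ring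
    linarith
  suffices hsum : ∑ ℓ ∈ (stateAfter PS I r t).tree.leaves,
      err ((stateAfter PS I r t).tree.dataAt I.S ℓ) ≤ 39 / 40 * I.ε * I.S.card by
    rw [trainError, div_le_iff₀ hS]
    refine le_trans hcount ?_
    linarith
  -- Majority labels on any tree err on at most half of S, and 1/2 < (39/40)(3/5). Below 3/5,
  -- log(1/ε) ≥ 1/2 allows additive constants to be absorbed into it.
  by_cases hε2 : 3 / 5 ≤ I.ε
  · have h1 := sum_err_leaves_le_half (stateAfter PS I r t).tree I.S
    have h2 := mul_le_mul_of_nonneg_right hε2 hS.le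
    linarith
  rw [not_le] at hε2
  have hl : 1 / 2 ≤ Real.log (1 / I.ε) := by
    have h1 : Real.exp (1 / 2) ≤ 5 / 3 := by
      have h2 : Real.exp (1 / 2) ^ 2 = Real.exp 1 := by
        rw [← Real.exp_nat_mul]; norm_num
      nlinarith [Real.exp_one_lt_d9, Real.exp_pos (1 / 2)]
    rw [Real.le_log_iff_exp_le (by positivity)]
    refine h1.trans ?_
    rw [le_div_iff₀ hε]
    linarith
  have hl2 := Real.log_two_lt_d9
  have hl2' := Real.log_two_gt_d9
  set l := Real.log (1 / I.ε) with hldef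
  have hL : Real.log (2 / I.ε) = Real.log 2 + l := by
    rw [hldef, ← Real.log_mul (by norm_num) (by positivity)]
    congr 1; ring
  have hpow : 0 < (1 / I.ε) ^ (100 * l / γ ^ 2) := by positivity
  have ht0 : (0 : ℝ) < t := hpow.trans_le ht
  have hlogt : 100 * l ^ 2 / γ ^ 2 ≤ Real.log t := by
    have h1 := Real.log_le_log hpow ht
    rw [Real.log_rpow (by positivity), ← hldef] at h1
    refine le_trans (le_of_eq ?_) h1
    ring
  have hlogt' : 100 * l ^ 2 ≤ γ ^ 2 * Real.log t := by
    rw [div_le_iff₀ (by positivity)] at hlogt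
    linarith
  -- Makes t + 1 at most 1.01 M in the count of light leaves.
  have ht100 : (100 : ℝ) ≤ t := by
    have h1 := Real.log_le_sub_one_of_pos ht0
    have h2 : 25 ≤ 100 * l ^ 2 := by nlinarith
    have h3 : 0 ≤ Real.log t := by
      by_contra hneg
      have := mul_nonpos_of_nonneg_of_nonpos (sq_nonneg γ) (not_le.1 hneg).le
      linarith
    have h4 := mul_le_mul_of_nonneg_right hγ2 h3
    linarith
  have hlarge : Real.log (5 / (2 * I.ε))
      ≤ 2 / 7 * γ ^ 2 / Real.log (2 / I.ε) * Real.log t := by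
    have h1 : Real.log (5 / (2 * I.ε)) ≤ 3 * l := by
      have h2 : 5 / (2 * I.ε) = 5 / 4 * (2 * (1 / I.ε)) := by field_simp; norm_num
      rw [h2, Real.log_mul (by norm_num) (by positivity),
        Real.log_mul (by norm_num) (by positivity), ← hldef]
      have := Real.log_le_sub_one_of_pos (show (0 : ℝ) < 5 / 4 by norm_num)
      linarith
    have hLpos : 0 < Real.log (2 / I.ε) := by rw [hL]; linarith
    refine h1.trans ?_
    rw [div_mul_eq_mul_div, le_div_iff₀ hLpos, hL]
    nlinarith
  have hq := hr.queueGood htM hS hα hB hnoise (by linarith) (by linarith) hn le_rfl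
  have hE := hr.queueSum_err_le htM (by exact_mod_cast ht0) hW hγ.le hlab hS hα hε hε1 hB hnoise
    hζ0 (by linarith) (by linarith) hn (by linarith) hlarge
  refine (hq.sum_err_leaves_le hw hS (by linarith)).trans ?_
  -- Since γ² ≤ 1/4, ζ ≤ ε/(52M). The total is then 2/5 + (1.01)(53/52)/2 < 39/40 in units of ε|S|.
  have h1 : I.ε / I.M + ζ ≤ 53 / 52 * (I.ε / I.M) := by linarith
  have h2 : ((t : ℝ) + 1) * (I.ε / I.M + ζ) ≤ 101 / 100 * I.M * (53 / 52 * (I.ε / I.M)) :=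
    mul_le_mul (by linarith) h1 (by linarith) (by positivity)
  have h3 : 101 / 100 * (I.M : ℝ) * (53 / 52 * (I.ε / I.M)) = 101 / 100 * (53 / 52) * I.ε := by
    field_simp
  have h4 := mul_le_mul_of_nonneg_right h2 hS.le
  rw [h3] at h4
  have h5 := mul_pos hε hS
  linarith

/-- With probability `1 - 2 * p` per leaf, all noises of the labelling are bounded. -/
theorem ofReal_le_infinitePi_labelNoise (T : Tree H) {s : ℝ} (hs : 0 ≤ s) :
    ENNReal.ofReal (1 - 2 * T.leaves.card * Real.exp (-s)) ≤
      Measure.infinitePi (fun _ : Address × Bool => laplace)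
        {z | ∀ ℓ ∈ T.leaves, ∀ y, |z (ℓ, y)| ≤ s} := by
  have h := ofReal_one_sub_card_mul_le_infinitePi laplace
    (T.leaves ×ˢ (Finset.univ : Finset Bool)) {x : ℝ | |x| ≤ s}
    (measurableSet_le measurable_abs measurable_const) (Real.exp_pos (-s)).le
    (ofReal_one_sub_exp_le_laplace hs)
  have hset : {z : Address × Bool → ℝ | ∀ ℓ ∈ T.leaves, ∀ y, |z (ℓ, y)| ≤ s}
      = {z | ∀ i ∈ T.leaves ×ˢ (Finset.univ : Finset Bool), z i ∈ {x : ℝ | |x| ≤ s}} := by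
    ext z
    simp only [Set.mem_ofPred_eq, Prod.forall, Finset.mem_product, Finset.mem_univ, and_true]
    exact ⟨fun h a y ha => h a ha y, fun h a ha y => h a y ha⟩
  rw [hset]
  refine le_trans (le_of_eq ?_) h
  rw [Finset.card_product, Finset.card_univ, Fintype.card_bool]
  push_cast
  ring_nf

end Main

end DPTree

end

theorem mainTheorem1 :
    ∃ C₁ C₂ c : ℝ, 0 < C₁ ∧ 0 < C₂ ∧ 0 < c ∧
      ∀ {X : Type*} (H : Set (X → Bool)) (f : X → Bool) (γ : ℝ),
        0 < γ → DPTree.WeakLearning H f γ →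
      ∀ {Ω : Type*} [MeasurableSpace Ω] (P : MeasureTheory.Measure Ω)
        [MeasureTheory.IsProbabilityMeasure P]
        (PS : DPTree.Splitter H Ω) (N : ℝ → ℝ → ℝ → ℝ),
        PS.IsMeasurable → PS.IsPrivate P f → PS.IsUseful P f N →
        (∀ ζ δ : ℝ, 0 < ζ → 0 < δ → δ ≤ 1 → AntitoneOn (fun α => N ζ α δ) (Set.Ioi 0)) →
      ∀ (I : DPTree.Input X) (b : ℝ),
        DPTree.LabelledBy f I.S → 0 < I.α → 0 < I.ε → I.ε ≤ 1 → 0 < I.δ → I.δ ≤ 1 →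
        (∑ d ∈ Finset.Icc 1 I.M, I.B d) ≤ 1 → IsLeast (I.B '' Set.Icc 1 I.M) b → 0 < b →
        max
          (C₂ * (I.M / (γ ^ 2 * I.ε * I.α * b)) * Real.log (2 / I.ε) * Real.log (2 * I.M / I.δ))
          (2 * I.M / I.ε *
            N (c * (γ ^ 2 * I.ε / (I.M * Real.log (2 / I.ε)))) (I.α * b / 4)
              (I.δ / (2 * (2 * I.M + 1))))
          ≤ (I.S.card : ℝ) →
      ∀ t : ℕ, (1 / I.ε) ^ (C₁ * Real.log (1 / I.ε) / γ ^ 2) ≤ (t : ℝ) → t ≤ I.M →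
        ENNReal.ofReal (1 - I.δ) ≤
          DPTree.runLaw P {r | DPTree.trainError I.S (DPTree.classifierAfter PS I t r) ≤ I.ε} := by
  -- The value 1/20 gives ζ ≤ γ²ε/(13M), because 20 log 2 > 13; the value 1000 gives ζ|S|αb ≥ 50
  -- log(2M/δ), which dominates the Laplace noise.
  refine ⟨100, 1000, 1 / 20, by norm_num, by norm_num, by norm_num, ?_⟩
  intro X H f γ hγ hW Ω _ P _ PS N _ _ hU hN I b hlab hα hε hε1 hδ hδ1 hBsum hb hb0 hmax t ht htM
  obtain ⟨hm1, hm2⟩ := max_le_iff.1 hmax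
  obtain ⟨⟨d₀, hd₀, -⟩, hlow⟩ := hb
  have hM : 1 ≤ I.M := hd₀.1.trans hd₀.2
  have hM1 : (1 : ℝ) ≤ I.M := by exact_mod_cast hM
  have hB : ∀ d ∈ Set.Icc 1 I.M, b ≤ I.B d := fun d hd => hlow ⟨d, hd, rfl⟩
  have hB0 : ∀ d ∈ Set.Icc 1 I.M, 0 < I.B d := fun d hd => hb0.trans_le (hB d hd)
  have hb1 : b ≤ 1 := by
    refine (hB 1 ⟨le_rfl, hM⟩).trans (le_trans ?_ hBsum)
    exact Finset.single_le_sum (f := I.B) (fun d hd => (hB0 d (Finset.mem_Icc.1 hd)).le)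
      (Finset.mem_Icc.2 ⟨le_rfl, hM⟩)
  have hl2 := Real.log_two_gt_d9
  have hL : Real.log 2 ≤ Real.log (2 / I.ε) :=
    Real.log_le_log (by norm_num) (by rw [le_div_iff₀ hε]; linarith)
  have hΛ : Real.log 2 ≤ Real.log (2 * I.M / I.δ) :=
    Real.log_le_log (by norm_num) (by rw [le_div_iff₀ hδ]; linarith)
  -- The noise level s = log(12M/δ) is chosen so that each Laplace variable exceeds it with
  -- probability at most δ/(12M).
  have hs6 : Real.log (12 * I.M / I.δ) ≤ 4 * Real.log (2 * I.M / I.δ) := by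
    have h1 : 12 * I.M / I.δ = 6 * (2 * I.M / I.δ) := by ring
    have h2 : Real.log 6 ≤ Real.log (2 ^ 3) := Real.log_le_log (by norm_num) (by norm_num)
    rw [Real.log_pow] at h2
    rw [h1, Real.log_mul (by norm_num) (by positivity)]
    push_cast at h2
    linarith
  have hs : 0 ≤ Real.log (12 * I.M / I.δ) :=
    Real.log_nonneg (by rw [le_div_iff₀ hδ]; linarith)
  have hp : Real.exp (-Real.log (12 * I.M / I.δ)) = I.δ / (12 * I.M) := by
    rw [Real.exp_neg, Real.exp_log (by positivity), inv_div]
  set L := Real.log (2 / I.ε)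
  set Λ := Real.log (2 * I.M / I.δ)
  set s := Real.log (12 * I.M / I.δ)
  have hL0 : 0 < L := by linarith
  have hΛ0 : 0 < Λ := by linarith
  have hS : (0 : ℝ) < I.S.card := lt_of_lt_of_le (by positivity) hm1
  have hX : Nonempty X := by
    obtain ⟨p, -⟩ := Multiset.card_pos_iff_exists_mem.1 (by exact_mod_cast hS : 0 < I.S.card)
    exact ⟨p.1⟩
  have hγ1 := hW.advantage_le_half
  have hA : 1000 * I.M * L * Λ ≤ I.S.card * (γ ^ 2 * I.ε * I.α * b) := by
    rw [← div_le_iff₀ (by positivity)]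
    refine le_trans (le_of_eq ?_) hm1
    ring
  set ζ := 1 / 20 * (γ ^ 2 * I.ε / (I.M * L)) with hζdef
  have hζ0 : 0 < ζ := by positivity
  have hζL : 20 * I.M * L * ζ = γ ^ 2 * I.ε := by rw [hζdef]; field_simp
  have hζ : ζ ≤ γ ^ 2 * I.ε / I.M / 13 := by
    rw [le_div_iff₀ (by norm_num), le_div_iff₀ (by positivity), ← hζL]
    have := mul_le_mul_of_nonneg_left (show 13 ≤ 20 * L by linarith)
      (show 0 ≤ ζ * I.M by positivity)
    linarith
  have hn : N ζ (I.α * b / 4) I.callDelta ≤ I.ε / I.M / 2 * I.S.card := by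
    have h1 := mul_le_mul_of_nonneg_left hm2 (show 0 ≤ I.ε / I.M / 2 by positivity)
    refine le_trans (le_of_eq ?_) h1
    unfold DPTree.Input.callDelta
    field_simp
  have hζmb : 50 * Λ ≤ ζ * (I.S.card * I.α * b) := by
    have h1 : 20 * I.M * L * (50 * Λ) ≤ 20 * I.M * L * (ζ * (I.S.card * I.α * b)) := by
      have : 20 * I.M * L * (ζ * (I.S.card * I.α * b))
          = I.S.card * (20 * I.M * L * ζ * I.α * b) := by ring
      rw [this, hζL]
      linarith
    exact le_of_mul_le_mul_left h1 (by positivity)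
  have hnoise : ∀ d ∈ Set.Icc 1 I.M, 2 / (I.S.card * (I.α / 2 * I.B d)) * s ≤ ζ := by
    intro d hd
    have hBd := hB0 d hd
    rw [div_mul_eq_mul_div, div_le_iff₀ (by positivity)]
    have h1 := mul_le_mul_of_nonneg_left (hB d hd)
      (show 0 ≤ ζ * (I.S.card * I.α) by positivity)
    linarith
  have hlabel : I.M * (16 / I.α * s) ≤ I.ε / 40 * I.S.card := by
    have h1 : γ ^ 2 * b ≤ 1 / 4 := by
      have : γ ^ 2 ≤ 1 / 4 := by nlinarith
      nlinarith [sq_nonneg γ]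
    have h2 := mul_le_mul_of_nonneg_left h1 (show 0 ≤ I.S.card * (I.ε * I.α) by positivity)
    have h3 := mul_le_mul_of_nonneg_left (show 69 / 100 ≤ L by linarith)
      (show 0 ≤ 1000 * I.M * Λ by positivity)
    have h4 : 690 * (I.M * Λ) ≤ I.S.card * (I.ε * I.α) * (1 / 4) := by linarith
    have h5 := mul_le_mul_of_nonneg_left hs6 (show (0 : ℝ) ≤ I.M by positivity)
    have h6 : I.M * (16 / I.α * s) = 16 * (I.M * s) / I.α := by ring
    rw [h6, div_le_iff₀ hα]
    linarith [mul_pos (mul_pos hS hε) hα]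
  have hcd : I.callDelta * (2 * (2 * I.M + 1)) = I.δ := by
    unfold DPTree.Input.callDelta
    field_simp
  have hcd0 : 0 < I.callDelta := by
    unfold DPTree.Input.callDelta
    positivity
  have hcd1 : I.callDelta ≤ 1 := by nlinarith
  have hεM : N ζ (I.α * b / 4) I.callDelta ≤ I.S.card := by
    have h1 : I.ε / I.M ≤ 1 := div_le_one_of_le₀ (by linarith) (by linarith)
    refine hn.trans (mul_le_of_le_one_left hS.le (by linarith))
  have hrun := DPTree.ofReal_le_infinitePi_runGood hU hN hζ0 hs hα hb0 hB hcd0 hcd1 hlab hεM hM htM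
  -- For a fixed successful run the tree is fixed, and the independent labelling noise at its at
  -- most 2M leaves fails with probability at most δ/3.
  have hprod := DPTree.mul_le_prod_of_forall_section
    (MeasureTheory.Measure.infinitePi fun _ : ℕ × Bool => P.prod DPTree.laplace)
    (MeasureTheory.Measure.infinitePi fun _ : DPTree.Address × Bool => DPTree.laplace)
    {r | DPTree.RunGood PS I ζ s (N ζ (I.α * b / 4) I.callDelta) t r}
    {r | DPTree.trainError I.S (DPTree.classifierAfter PS I t r) ≤ I.ε}
    (ENNReal.ofReal (1 - I.δ / 3)) fun r hr => by
      have hlab' := DPTree.ofReal_le_infinitePi_labelNoise (DPTree.stateAfter PS I r t).tree hs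
      refine le_trans (ENNReal.ofReal_le_ofReal ?_) (hlab'.trans (MeasureTheory.measure_mono ?_))
      · have h1 : ((DPTree.stateAfter PS I r t).tree.leaves.card : ℝ) ≤ 2 * I.M := by
          have := (DPTree.wellFormed_stateAfter PS I r t).card_leaves
          exact_mod_cast (by omega : (DPTree.stateAfter PS I r t).tree.leaves.card ≤ 2 * I.M)
        have h2 := mul_le_mul_of_nonneg_right h1 (show 0 ≤ 2 * (I.δ / (12 * I.M)) by positivity)
        have h3 : 2 * I.M * (2 * (I.δ / (12 * I.M))) = I.δ / 3 := by field_simp; norm_num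
        rw [hp]
        linarith
      · intro z hz
        exact hr.trainError_le hz hW hγ hγ1 hlab hS hα hε hε1 hM hB0 hnoise hζ0.le hζ hn hs hlabel
          ht htM
  refine le_trans ?_ hprod
  refine le_trans ?_ (mul_le_mul_left hrun _)
  -- Failure budget: δ/2 for at most 2M + 1 calls of PrivateSplit, δ/6 for the noise in the weights,
  -- δ/3 for the labelling.
  refine le_trans (ENNReal.ofReal_le_ofReal ?_)
    (DPTree.ofReal_one_sub_mul_ofReal_one_sub (by positivity) (by positivity))
  rw [hp]
  have htM' : (t : ℝ) ≤ I.M := by exact_mod_cast htM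
  have h1 := mul_le_mul_of_nonneg_right htM'
    (show 0 ≤ 2 * (I.callDelta + I.δ / (12 * I.M)) by positivity)
  have h2 : I.M * (2 * (I.callDelta + I.δ / (12 * I.M))) = 2 * I.M * I.callDelta + I.δ / 6 := by
    field_simp; ring
  linarith
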